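/- Let $G$ be a compactly generated unimodular totally disconnected locally compact group with rational discrete cohomological dimension $\mathrm{cd}_{\mathbb Q}(G)\le 1$. Here a $\mathbb Q[G]$-module is discrete if all stabilisers of its elements are open; $\mathrm{dH}^n(G,-)$ is the $n$-th right derived functor of the fixed-point functor $M\mapsto M^G$ on the category of discrete $\mathbb Q[G]$-modules; and $\mathrm{cd}_{\mathbb Q}(G)=\sup\{n\ge 0 : \mathrm{dH}^n(G,-)\neq 0\}$. For a compact open subgroup $U$ of $G$ let $\mu_U$ be the Haar measure of $G$ with $\mu_U(U)=1$, and let $\mathbf h(G)$ be the one-dimensional $\mathbb Q$-vector space spanned by these measures, ordered by $\nu\le\nu'$ iff $\nu'-\nu$ is non-negative. For a finitely generated projective discrete $\mathbb Q[G]$-module $P$, choose a compact open subgroup $O$, an $n\ge 0$, and an idempotent $e=(e_{jk})\in \mathrm{End}_G(\mathbb Q[G/O]^n)$ with image isomorphic to $P$; the Hattori–Stallings rank of $P$ is $\tilde\rho(P)=\big(\sum_j c_j\big)\mu_O\in\mathbf h(G)$, where $c_j$ is the coefficient of the coset $O$ in $e_{jj}(O)\in\mathbb Q[G/O]$. This does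 not depend on the choices, because $G$ is unimodular. A discrete module $M$ is of type $\mathrm{FP}$ if it has a finite resolution $0\to P_n\to\dots\to P_0\to M\to 0$ by finitely generated projective discrete $\mathbb Q[G]$-modules; then $\tilde\rho(M)=\sum_i(-1)^i\tilde\rho(P_i)$. The group $G$ is of type $\mathrm{FP}$ if the trivial module $\mathbb Q$ is, and then its Euler–Poincaré characteristic is $\tilde\chi_G=\tilde\rho(\mathbb Q)$. Let $N_U^G$ be the kernel of the augmentation $\mathbb Q[G/U]\to\mathbb Q$, $gU\mapsto 1$. Then $G$ is of type $\mathrm{FP}$, and for every compact open subgroup $U\neq G$ the module $N_U^G$ is a finitely generated projective discrete $\mathbb Q[G]$-module with $$\tilde\rho(N_U^G)\ \ge\ \tfrac12\,\mu_U ,\qquad\text{and}\qquad \tilde\chi_G\ \le\ \tfrac12\,\mu_U .$$ -/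

import Mathlib

open MeasureTheory

noncomputable section

namespace TDLC

universe u w

section Groups

variable (G : Type*) [Group G] [TopologicalSpace G]

/-- A compact open subgroup of a topological group. -/
structure CompactOpenSubgroup extends Subgroup G where
  isOpen' : IsOpen carrier
  isCompact' : IsCompact carrier

/-- A topological group is compactly generated if it is generated by a compact subset. -/
def IsCompactlyGenerated : Prop :=
  ∃ K : Set G, IsCompact K ∧ Subgroup.closure K = ⊤

/-- A locally compact group is unimodular if its left Haar measure is right invariant. -/
def IsUnimodular [IsTopologicalGroup G] [LocallyCompactSpace G] [MeasurableSpace G]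
    [BorelSpace G] : Prop :=
  (Measure.haar : Measure G).IsMulRightInvariant

end Groups

/-! ### The space of rational multiples of Haar measures -/

section HaarSpace

variable {G : Type*} [Group G] [TopologicalSpace G] [IsTopologicalGroup G]
  [LocallyCompactSpace G] [MeasurableSpace G] [BorelSpace G]

/-- A compact open subgroup as a compact set with non-empty interior. -/
def CompactOpenSubgroup.toPositiveCompacts (O : CompactOpenSubgroup G) :
    TopologicalSpace.PositiveCompacts G where
  carrier := O.toSubgroup
  isCompact' := O.isCompact'
  interior_nonempty' := by
    have h : interior (O.toSubgroup : Set G) = O.toSubgroup := O.isOpen'.interior_eq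
    rw [h]
    exact ⟨1, O.toSubgroup.one_mem⟩

/-- The left Haar measure `μ_O` on `G` with `μ_O(O) = 1`. -/
def CompactOpenSubgroup.haarMeasure (O : CompactOpenSubgroup G) : Measure G :=
  Measure.haarMeasure O.toPositiveCompacts

instance (O : CompactOpenSubgroup G) : O.haarMeasure.IsHaarMeasure :=
  Measure.isHaarMeasure_haarMeasure O.toPositiveCompacts

/-- The Haar measure `μ_O`, regarded as the functional `f ↦ ∫ f dμ_O` on the compactly supported
continuous functions (this allows negative multiples). -/
def CompactOpenSubgroup.haarFunctional (O : CompactOpenSubgroup G) :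
    CompactlySupportedContinuousMap G ℝ →ₗ[ℝ] ℝ :=
  (CompactlySupportedContinuousMap.integralPositiveLinearMap O.haarMeasure).toLinearMap

variable (G) in
/-- The `ℚ`-vector space `h(G)` spanned by the Haar measures `μ_O`, for `O` a compact open
subgroup. (Any two of them are positive rational multiples of each other.) -/
def haarSpace : Submodule ℚ (CompactlySupportedContinuousMap G ℝ →ₗ[ℝ] ℝ) :=
  Submodule.span ℚ (Set.range fun O : CompactOpenSubgroup G => O.haarFunctional)

/-- The Haar measure `μ_O` as an element of `h(G)`. -/
def CompactOpenSubgroup.haar (O : CompactOpenSubgroup G) : haarSpace G :=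
  ⟨O.haarFunctional, Submodule.subset_span ⟨O, rfl⟩⟩

/-- The order on `h(G)`: `ν ≤ ν'` if `ν' - ν` is a non-negative measure. -/
instance : LE (haarSpace G) where
  le ν ν' := ∀ f : CompactlySupportedContinuousMap G ℝ, 0 ≤ f →
    (ν : CompactlySupportedContinuousMap G ℝ →ₗ[ℝ] ℝ) f ≤
      (ν' : CompactlySupportedContinuousMap G ℝ →ₗ[ℝ] ℝ) f

end HaarSpace

/-! ### Discrete `ℚ[G]`-modules -/

section Modules

variable {G : Type u} [Group G] [TopologicalSpace G]

/-- A `ℚ[G]`-module is discrete if the stabiliser of each of its elements is open (equivalently,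
if the action `G × M → M` is continuous for the discrete topology on `M`). -/
def IsDiscrete {V : Type w} [AddCommGroup V] [Module ℚ V] (ρ : Representation ℚ G V) : Prop :=
  ∀ v : V, IsOpen {g : G | ρ g v = v}

/-- Finite generation as a `ℚ[G]`-module. -/
def IsFinitelyGenerated (P : Rep.{u} ℚ G) : Prop :=
  ∃ s : Finset P, Submodule.span ℚ {x : P | ∃ g : G, ∃ m ∈ s, x = P.ρ g m} = ⊤

/-- Projectivity in the category of discrete `ℚ[G]`-modules. -/
def IsProjective (P : Rep.{u} ℚ G) : Prop :=
  IsDiscrete P.ρ ∧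
    ∀ A B : Rep.{u} ℚ G, IsDiscrete A.ρ → IsDiscrete B.ρ →
      ∀ (f : A.ρ.IntertwiningMap B.ρ) (g : P.ρ.IntertwiningMap B.ρ), Function.Surjective f →
        ∃ h : P.ρ.IntertwiningMap A.ρ, f.comp h = g

/-- Injectivity in the category of discrete `ℚ[G]`-modules. -/
def IsInjective (I : Rep.{u} ℚ G) : Prop :=
  IsDiscrete I.ρ ∧
    ∀ A B : Rep.{u} ℚ G, IsDiscrete A.ρ → IsDiscrete B.ρ →
      ∀ (f : A.ρ.IntertwiningMap B.ρ) (g : A.ρ.IntertwiningMap I.ρ), Function.Injective f →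
        ∃ h : B.ρ.IntertwiningMap I.ρ, h.comp f = g

/-! ### Rational discrete cohomology -/

/-- An injective resolution `0 → M → I⁰ → I¹ → ⋯` in the category of discrete
`ℚ[G]`-modules. -/
structure InjectiveResolution (M : Rep.{u} ℚ G) where
  I : ℕ → Rep.{u} ℚ G
  injective : ∀ n, IsInjective (I n)
  ι : M.ρ.IntertwiningMap (I 0).ρ
  d : ∀ n, (I n).ρ.IntertwiningMap (I (n + 1)).ρ
  ι_injective : Function.Injective ι
  exact_zero : Function.Exact ι (d 0)
  exact_succ : ∀ n, Function.Exact (d n) (d (n + 1))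

namespace InjectiveResolution

variable {M : Rep.{u} ℚ G} (R : InjectiveResolution M)

/-- The differential `(Iⁿ)^G → (Iⁿ⁺¹)^G` of the complex of fixed points. -/
def dInvariants (n : ℕ) : (R.I n).ρ.invariants →ₗ[ℚ] (R.I (n + 1)).ρ.invariants :=
  (R.d n).toLinearMap.restrict fun v hv g => by
    have h := Representation.IntertwiningMap.isIntertwining _ _ (R.d n) g v
    rw [hv g] at h
    exact h.symm

/-- The `n`-coboundaries of the complex of fixed points. -/
def coboundaries : (n : ℕ) → Submodule ℚ (R.I n).ρ.invariants
  | 0 => ⊥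
  | n + 1 => LinearMap.range (R.dInvariants n)

/-- The `n`-th cohomology of the complex of fixed points `(I⁰)^G → (I¹)^G → ⋯`, that is, the value
`dHⁿ(G, M)` of the `n`-th right derived functor of the fixed-point functor, computed by means of
the given injective resolution of `M`. -/
abbrev dH (n : ℕ) : Type u :=
  LinearMap.ker (R.dInvariants n) ⧸
    (R.coboundaries n).comap (LinearMap.ker (R.dInvariants n)).subtype

end InjectiveResolution

variable (G) in
/-- The rational discrete cohomological dimension
`cd_ℚ(G) = sup {n | dHⁿ(G, -) ≠ 0}`. -/
def cdQ : ℕ∞ :=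
  sSup {k : ℕ∞ | ∃ n : ℕ, k = n ∧ ∃ M : Rep.{u} ℚ G, IsDiscrete M.ρ ∧
    ∃ R : InjectiveResolution M, Nontrivial (R.dH n)}

/-! ### Permutation modules and augmentation modules -/

/-- The transitive permutation module `ℚ[G/O]`. -/
abbrev perm (O : CompactOpenSubgroup G) :
    Representation ℚ G (MonoidAlgebra ℚ (G ⧸ O.toSubgroup)) :=
  Representation.ofMulAction ℚ G (G ⧸ O.toSubgroup)

/-- The augmentation `ℚ[G/U] → ℚ`, `gU ↦ 1`. -/
def augmentation (U : CompactOpenSubgroup G) :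
    (perm U).IntertwiningMap (Representation.trivial ℚ G ℚ) where
  toLinearMap := Finsupp.linearCombination ℚ (fun _ : G ⧸ U.toSubgroup => (1 : ℚ)) ∘ₗ
    (MonoidAlgebra.coeffLinearEquiv ℚ).toLinearMap
  isIntertwining' g := by
    ext x
    simp

/-- The discrete augmentation module `N_U^G`, the kernel of the augmentation `ℚ[G/U] → ℚ`. -/
def augmentationModule (U : CompactOpenSubgroup G) : Rep.{u} ℚ G :=
  Rep.of (augmentation U).ker.toRepresentation

/-! ### Hattori–Stallings ranks and the Euler–Poincaré characteristic -/

/-- A finite resolution `0 → P_n → ⋯ → P_0 → M → 0`, `n = length`, of `M` by finitely generated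
projective discrete `ℚ[G]`-modules (with `P_i = 0` for `i > n`). -/
structure FiniteProjectiveResolution {V : Type w} [AddCommGroup V] [Module ℚ V]
    (ρ : Representation ℚ G V) where
  length : ℕ
  P : ℕ → Rep.{u} ℚ G
  projective : ∀ i, IsProjective (P i)
  finitelyGenerated : ∀ i, IsFinitelyGenerated (P i)
  subsingleton : ∀ i, length < i → Subsingleton (P i)
  ε : (P 0).ρ.IntertwiningMap ρ
  d : ∀ i, (P (i + 1)).ρ.IntertwiningMap (P i).ρ
  ε_surjective : Function.Surjective ε
  exact_zero : Function.Exact (d 0) ε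
  exact_succ : ∀ i, Function.Exact (d (i + 1)) (d i)

variable (G) in
/-- `G` is of type `FP` if the trivial module `ℚ` has a finite resolution by finitely generated
projective discrete `ℚ[G]`-modules. -/
def IsTypeFP : Prop :=
  Nonempty (FiniteProjectiveResolution (Representation.trivial ℚ G ℚ))

/-- A presentation of `P` as a direct summand of `ℚ[G/O]ⁿ`, for some compact open subgroup `O` and
some `n`: maps `i = (i_j) : P → ℚ[G/O]ⁿ` and `r = (r_j) : ℚ[G/O]ⁿ → P` with `r ∘ i = id`. -/
structure Splitting (P : Rep.{u} ℚ G) where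
  O : CompactOpenSubgroup G
  n : ℕ
  i : Fin n → P.ρ.IntertwiningMap (perm O)
  r : Fin n → (perm O).IntertwiningMap P.ρ
  sum_comp : ∑ j, (r j).comp (i j) = Representation.IntertwiningMap.id P.ρ

/-- The trace of an endomorphism of `ℚ[G/O]`, i.e. the coefficient at `O` of the image of `O`.
If the endomorphism is right convolution with the element `f` of the Hecke algebra, this is
`f(1)`. -/
def permTrace {O : CompactOpenSubgroup G} (α : (perm O).IntertwiningMap (perm O)) : ℚ :=
  (α (MonoidAlgebra.single ((1 : G) : G ⧸ O.toSubgroup) 1)).coeff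
    ((1 : G) : G ⧸ O.toSubgroup)

variable [IsTopologicalGroup G] [LocallyCompactSpace G] [MeasurableSpace G] [BorelSpace G]

/-- The trace of the idempotent matrix `e = (i_j ∘ r_k)` defining `P`, times `μ_O`. -/
def Splitting.rank {P : Rep.{u} ℚ G} (s : Splitting P) : haarSpace G :=
  (∑ j, permTrace ((s.i j).comp (s.r j))) • s.O.haar

open Classical in
/-- The Hattori–Stallings rank `ρ̃(P)` of a finitely generated projective discrete `ℚ[G]`-module
`P` over a unimodular group: write `P` as the image of an idempotent endomorphism `e` of
`ℚ[G/O]ⁿ`, and take the trace of `e` times `μ_O`. For unimodular `G`, the result does not depend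
on the presentation of `P`. -/
def hsRank (P : Rep.{u} ℚ G) : haarSpace G :=
  if h : Nonempty (Splitting P) then h.some.rank else 0

/-- The Hattori–Stallings rank `ρ̃(M) = ∑ i, (-1)ⁱ ρ̃(Pᵢ)` with respect to a finite resolution of
`M` by finitely generated projective modules. -/
def FiniteProjectiveResolution.rank {V : Type w} [AddCommGroup V] [Module ℚ V]
    {ρ : Representation ℚ G V} (R : FiniteProjectiveResolution ρ) : haarSpace G :=
  ∑ i ∈ Finset.range (R.length + 1), (-1 : ℚ) ^ i • hsRank (R.P i)

open Classical in
/-- The Hattori–Stallings rank `ρ̃(M)` of a discrete module `M` of type `FP` over a unimodular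
group. For unimodular `G`, the result does not depend on the chosen resolution. -/
def hsRankFP {V : Type w} [AddCommGroup V] [Module ℚ V] (ρ : Representation ℚ G V) :
    haarSpace G :=
  if h : Nonempty (FiniteProjectiveResolution ρ) then h.some.rank else 0

variable (G) in
/-- The Euler–Poincaré characteristic `χ̃_G = ρ̃(ℚ)` of a unimodular group `G` of type `FP`. -/
def eulerChar : haarSpace G :=
  hsRankFP (Representation.trivial ℚ G ℚ)

end Modules

end TDLC

end

open MeasureTheory Representation

noncomputable section

namespace TDLC

universe u w

/-! Write `N` for the augmentation module of `U`. If `F` is projective and maps onto `ℚ` with kernel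
`L`, dimension shifting embeds `Ext¹(L, K)` in `Ext²(ℚ, K) = dH²(G, K)`, which vanishes when `cdQ G
≤ 1`. So such kernels are projective (`isProjective_ker`), in particular `N`. Compact generation
makes `N` finitely generated, because `g ↦ gU - U` is a cocycle determined by its values on a
generating set. Hence `0 → N → ℚ[G/U] → ℚ → 0` is a finite projective resolution and `G` is of type
`FP`.

All facts about ranks come from one cyclicity property, `tr (ψ φ) = tr (φ ψ)`
(`Splitting.trace_comp_comm`), which is the mass transport principle of a unimodular group. It gives
independence of the presentation, additivity, and Schanuel's lemma, hence `χ = μ_U - ρ(N)` for any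
resolution (`coe_rank_eq`). Both inequalities therefore reduce to `ρ(N) ≥ μ_U / 2`.

That bound is an estimate of von Neumann dimension. Present `N` by an idempotent on `ℚ[G/O]ⁿ`; it
extends to a bounded equivariant idempotent `e` on `ℓ²` (Schur's test). The map `ℚ[G/O]ⁿ → N →
ℚ[G/U]` extends to an operator `T` with `T e = T`, whose range contains `δ_U - δ_{gU}` for some `g ∉
U`. The closure of the range has dimension at most the normalised trace of `e`. If `z` is the
projection of `δ_U` to the orthogonal complement of the range, then `⟪z, δ_U⟫ = ⟪z, δ_{gU}⟫ = ‖z‖²`,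
which forces `‖z‖² ≤ 1/2`; so the range has dimension at least half that of `ℓ²(G/U)`. Projections
onto range closures are approximated by polynomials in `T T*` and `T* T`, for which cyclicity of the
trace is available (`opTrace_one_sub_pow_le`, `half_le_opTrace`). -/

/-! ### Compact open subgroups -/

section CompactOpen

variable {G : Type*} [Group G] [TopologicalSpace G]

/-- The intersection of a compact open subgroup with an open subgroup. -/
def CompactOpenSubgroup.inf [IsTopologicalGroup G] (U : CompactOpenSubgroup G) (S : Subgroup G)
    (hS : IsOpen (S : Set G)) : CompactOpenSubgroup G where
  toSubgroup := U.toSubgroup ⊓ S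
  isOpen' := U.isOpen'.inter hS
  isCompact' := U.isCompact'.inter_right (Subgroup.isClosed_of_isOpen S hS)

/-- Van Dantzig's theorem. -/
theorem nonempty_compactOpenSubgroup [IsTopologicalGroup G] [LocallyCompactSpace G]
    [TotallyDisconnectedSpace G] : Nonempty (CompactOpenSubgroup G) := by
  obtain ⟨K, hK, hK1⟩ := exists_compact_mem_nhds (1 : G)
  obtain ⟨W, hW, h1W, hWK⟩ := (loc_compact_Haus_tot_disc_of_zero_dim (H := G)).mem_nhds_iff.1 hK1
  have hWc : IsCompact W := hK.of_isClosed_subset hW.1 hWK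
  obtain ⟨V, hV, hVW⟩ := compact_open_separated_mul_left hWc hW.2 subset_rfl
  open scoped Pointwise in
  let H : Subgroup G := MulAction.stabilizer G W
  have hHW : (H : Set G) ⊆ W := by
    intro g hg
    have : g • (1 : G) ∈ g • W := Set.smul_mem_smul_set h1W
    rw [show g • W = W from hg] at this
    simpa using this
  have hHo : IsOpen (H : Set G) := by
    refine H.isOpen_of_mem_nhds (g := 1) (Filter.mem_of_superset
      (Filter.inter_mem hV (inv_mem_nhds_one G hV)) ?_)
    rintro g ⟨hg, hg'⟩
    refine Set.Subset.antisymm ?_ ?_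
    · rintro _ ⟨x, hx, rfl⟩
      exact hVW (Set.mul_mem_mul hg hx)
    · intro x hx
      exact ⟨g⁻¹ * x, hVW (Set.mul_mem_mul hg' hx), by simp⟩
  exact ⟨⟨H, hHo, hWc.of_isClosed_subset (H.isClosed_of_isOpen hHo) hHW⟩⟩

theorem CompactOpenSubgroup.exists_le [IsTopologicalGroup G] [LocallyCompactSpace G]
    [TotallyDisconnectedSpace G] (S : Subgroup G) (hS : IsOpen (S : Set G)) :
    ∃ U : CompactOpenSubgroup G, U.toSubgroup ≤ S :=
  ⟨(nonempty_compactOpenSubgroup (G := G)).some.inf S hS, inf_le_right⟩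

theorem CompactOpenSubgroup.discreteTopology_quotient [IsTopologicalGroup G]
    (U : CompactOpenSubgroup G) :
    DiscreteTopology (G ⧸ U.toSubgroup) :=
  QuotientGroup.discreteTopology U.isOpen'

/-- The balls around the base coset for a symmetrised compact generating set are compact in a
discrete space, hence finite, and they exhaust `G/U`. Countability is what lets Haar integrals of
functions on `G/U` be written as sums. -/
theorem countable_quotient [IsTopologicalGroup G] (hG : IsCompactlyGenerated G)
    (U : CompactOpenSubgroup G) : Countable (G ⧸ U.toSubgroup) := by
  obtain ⟨K, hK, hKG⟩ := hG
  have := U.discreteTopology_quotient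
  let S : Set G := K ∪ K⁻¹
  have hS : IsCompact S := hK.union hK.inv
  let C : ℕ → Set (G ⧸ U.toSubgroup) := fun n => n.rec {((1 : G) : G ⧸ U.toSubgroup)}
    fun _ D => (fun p : G × (G ⧸ U.toSubgroup) => p.1 • p.2) '' (S ×ˢ D)
  have hC : ∀ n, (C n).Finite := by
    intro n
    induction n with
    | zero => exact Set.finite_singleton _
    | succ n ih =>
      exact ((hS.prod ih.isCompact).image continuous_smul).finite_of_discrete
  have hcov : ∀ g : G, ∀ n, ∀ x ∈ C n, g • x ∈ ⋃ m, C m := by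
    intro g
    have hg : g ∈ Subgroup.closure K := hKG ▸ Subgroup.mem_top g
    have key : ∀ s ∈ S, ∀ n, ∀ x ∈ C n, s • x ∈ ⋃ m, C m := fun s hs n x hx =>
      Set.mem_iUnion.2 ⟨n + 1, (s, x), ⟨hs, hx⟩, rfl⟩
    induction hg using Subgroup.closure_induction'' with
    | mem x hx => exact key x (Or.inl hx)
    | inv_mem x hx => exact key _ (Or.inr (by simpa using hx))
    | one => intro n x hx; rw [one_smul]; exact Set.mem_iUnion.2 ⟨n, hx⟩
    | mul a b _ _ ha hb =>
      intro n x hx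
      obtain ⟨m, hm⟩ := Set.mem_iUnion.1 (hb n x hx)
      rw [mul_smul]
      exact ha m _ hm
  have huniv : (⋃ m, C m) = Set.univ := by
    refine Set.eq_univ_of_forall fun y => ?_
    induction y using QuotientGroup.induction_on with
    | H g =>
      have := hcov g 0 ((1 : G) : G ⧸ U.toSubgroup) rfl
      simpa [← MulAction.Quotient.smul_coe] using this
  rw [← Set.countable_univ_iff, ← huniv]
  exact Set.countable_iUnion fun n => (hC n).countable

end CompactOpen

/-! ### Haar measure and mass transport -/

section Haar

variable {G : Type*} [Group G] [TopologicalSpace G] [IsTopologicalGroup G]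
  [LocallyCompactSpace G] [MeasurableSpace G] [BorelSpace G]

/-- The inverted measure is again left invariant, so it is `c • μ` by uniqueness of Haar measure;
inverting twice gives `c ^ 2 = 1`. -/
theorem IsUnimodular.isInvInvariant (h : IsUnimodular G) :
    (Measure.haar : Measure G).IsInvInvariant := by
  let μ : Measure G := Measure.haar
  have : μ.IsMulRightInvariant := h
  constructor
  let c : ENNReal := Measure.haarScalarFactor μ.inv μ
  have hc : μ.inv = c • μ := Measure.isMulLeftInvariant_eq_smul_of_regular μ.inv μ
  have h2 : Measure.map Inv.inv (Measure.map Inv.inv μ) = c ^ 2 • μ := by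
    rw [← Measure.inv_def μ, hc, Measure.map_smul, ← Measure.inv_def μ, hc, smul_smul, pow_two]
  have μeq : μ = c ^ 2 • μ := by
    rw [Measure.map_map continuous_inv.measurable continuous_inv.measurable] at h2
    have h5 : (Inv.inv ∘ Inv.inv : G → G) = id := inv_involutive.comp_self
    rw [← h2, h5, Measure.map_id]
  have K : TopologicalSpace.PositiveCompacts G := Classical.arbitrary _
  have h3 : c ^ 2 * μ K = 1 ^ 2 * μ K := by
    conv_rhs => rw [μeq]
    simp
  have h4 : c ^ 2 = 1 ^ 2 :=
    (ENNReal.mul_left_inj (Measure.measure_pos_of_nonempty_interior _ K.interior_nonempty).ne'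
          K.isCompact.measure_lt_top.ne).1 h3
  have : c = 1 := (ENNReal.pow_right_strictMono two_ne_zero).injective h4
  change μ.inv = μ
  rw [hc, this, one_smul]

/-- The volume of a compact open subgroup. -/
def CompactOpenSubgroup.vol (O : CompactOpenSubgroup G) : ℝ :=
  (Measure.haar : Measure G).real (O.toSubgroup : Set G)

theorem CompactOpenSubgroup.haar_ne_top (O : CompactOpenSubgroup G) :
    (Measure.haar : Measure G) (O.toSubgroup : Set G) ≠ ⊤ :=
  O.isCompact'.measure_lt_top.ne

theorem CompactOpenSubgroup.vol_pos (O : CompactOpenSubgroup G) : 0 < O.vol :=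
  ENNReal.toReal_pos (O.isOpen'.measure_pos _ ⟨1, O.toSubgroup.one_mem⟩).ne' O.haar_ne_top

/-- The functional defined by the reference Haar measure. -/
def haarIntegral : CompactlySupportedContinuousMap G ℝ →ₗ[ℝ] ℝ :=
  (CompactlySupportedContinuousMap.integralPositiveLinearMap
    (Measure.haar : Measure G)).toLinearMap

theorem haarIntegral_apply (f : CompactlySupportedContinuousMap G ℝ) :
    haarIntegral f = ∫ x, f x ∂(Measure.haar : Measure G) := rfl

/-- Expressing every `μ_O` through one reference measure turns identities and inequalities in
`haarSpace G` into statements about real numbers. -/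
theorem CompactOpenSubgroup.haarFunctional_eq (O : CompactOpenSubgroup G) :
    O.haarFunctional = O.vol⁻¹ • haarIntegral := by
  have h : (Measure.haar : Measure G)
      = Measure.haarScalarFactor (Measure.haar : Measure G) O.haarMeasure • O.haarMeasure := by
    have : O.haarMeasure.Regular := Measure.regular_haarMeasure
    exact Measure.isMulLeftInvariant_eq_smul_of_regular _ _
  set c := Measure.haarScalarFactor (Measure.haar : Measure G) O.haarMeasure
  have hO : O.haarMeasure (O.toSubgroup : Set G) = 1 :=
    Measure.haarMeasure_self (K₀ := O.toPositiveCompacts)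
  have hv : O.vol = c := by
    rw [vol, Measure.real, h, Measure.smul_apply, hO]
    simp
  have hc : (c : ℝ) ≠ 0 := hv ▸ O.vol_pos.ne'
  ext f
  rw [LinearMap.smul_apply, haarIntegral_apply, h, integral_smul_nnreal_measure, hv]
  change ∫ x, f x ∂O.haarMeasure = _
  rw [NNReal.smul_def, smul_eq_mul, smul_eq_mul, inv_mul_cancel_left₀ hc]

theorem haarIntegral_nonneg (f : CompactlySupportedContinuousMap G ℝ) (hf : 0 ≤ f) :
    0 ≤ haarIntegral f :=
  integral_nonneg hf

section Transport

/-- The fibres of `G → G/V` are left translates of `V`, so each has the volume of `V`. -/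
theorem map_quotient_haar (V : CompactOpenSubgroup G) [Countable (G ⧸ V.toSubgroup)] :
    letI : MeasurableSpace (G ⧸ V.toSubgroup) := ⊤
    (Measure.haar : Measure G).map (QuotientGroup.mk : G → G ⧸ V.toSubgroup) =
      (Measure.haar : Measure G) (V.toSubgroup : Set G) • Measure.count := by
  let _ : MeasurableSpace (G ⧸ V.toSubgroup) := ⊤
  have := V.discreteTopology_quotient
  have hm : Measurable (QuotientGroup.mk : G → G ⧸ V.toSubgroup) := fun s _ =>
    ((isOpen_discrete s).preimage QuotientGroup.continuous_mk).measurableSet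
  refine Measure.ext_of_singleton fun y => ?_
  induction y using QuotientGroup.induction_on with
  | H g =>
    rw [Measure.map_apply hm trivial, Measure.smul_apply, Measure.count_singleton, smul_eq_mul,
      mul_one]
    have : (QuotientGroup.mk ⁻¹' {(g : G ⧸ V.toSubgroup)} : Set G)
        = (fun x => g⁻¹ * x) ⁻¹' (V.toSubgroup : Set G) := by
      ext x
      simp only [Set.mem_preimage, Set.mem_singleton_iff, SetLike.mem_coe]
      rw [eq_comm, QuotientGroup.eq]
    rw [this, measure_preimage_mul]

theorem summable_iff_integrable_quotient (V : CompactOpenSubgroup G)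
    [Countable (G ⧸ V.toSubgroup)] (F : G ⧸ V.toSubgroup → ℝ) :
    Summable F ↔ Integrable (fun g : G => F g) (Measure.haar : Measure G) := by
  let _ : MeasurableSpace (G ⧸ V.toSubgroup) := ⊤
  have := V.discreteTopology_quotient
  have hm : Measurable (QuotientGroup.mk : G → G ⧸ V.toSubgroup) := fun s _ =>
    ((isOpen_discrete s).preimage QuotientGroup.continuous_mk).measurableSet
  have h := integrable_map_measure (f := (QuotientGroup.mk : G → G ⧸ V.toSubgroup))
    (μ := (Measure.haar : Measure G)) (g := F)
    (measurable_from_top.aestronglyMeasurable) hm.aemeasurable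
  change _ ↔ Integrable (F ∘ QuotientGroup.mk) _
  rw [← h, map_quotient_haar, integrable_smul_measure
    (c := (Measure.haar : Measure G) (V.toSubgroup : Set G))
    (V.isOpen'.measure_pos _ ⟨1, V.toSubgroup.one_mem⟩).ne' V.haar_ne_top, integrable_count_iff,
    summable_norm_iff]

theorem integral_quotient (V : CompactOpenSubgroup G)
    [Countable (G ⧸ V.toSubgroup)] (F : G ⧸ V.toSubgroup → ℝ) :
    ∫ g : G, F g ∂(Measure.haar : Measure G) = V.vol * ∑' y, F y := by
  let _ : MeasurableSpace (G ⧸ V.toSubgroup) := ⊤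
  have := V.discreteTopology_quotient
  have hm : Measurable (QuotientGroup.mk : G → G ⧸ V.toSubgroup) := fun s _ =>
    ((isOpen_discrete s).preimage QuotientGroup.continuous_mk).measurableSet
  by_cases hF : Summable F
  · have h := integral_map (f := F) (φ := (QuotientGroup.mk : G → G ⧸ V.toSubgroup))
      (μ := (Measure.haar : Measure G)) hm.aemeasurable
      (measurable_from_top.aestronglyMeasurable)
    rw [← h, map_quotient_haar, integral_smul_measure, integral_countable]
    · simp [CompactOpenSubgroup.vol, Measure.real]
    · rw [integrable_count_iff, summable_norm_iff]; exact hF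
  -- Without summability both sides take the default value 0.
  · rw [tsum_eq_zero_of_not_summable hF, mul_zero, integral_undef]
    rwa [← summable_iff_integrable_quotient]

/-- The mass transport principle for a unimodular group, summability. -/
theorem summable_transport (huni : IsUnimodular G) (O V : CompactOpenSubgroup G)
    [Countable (G ⧸ O.toSubgroup)] [Countable (G ⧸ V.toSubgroup)]
    (f : G ⧸ O.toSubgroup → G ⧸ V.toSubgroup → ℝ)
    (hf : ∀ (g : G) x y, f (g • x) (g • y) = f x y) :
    Summable (f (1 : G)) ↔ Summable fun x => f x (1 : G) := by
  have := huni.isInvInvariant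
  -- Translating by `g` exchanges the two arguments at the cost of inverting the group variable,
  -- which inversion invariance of Haar measure absorbs.
  have h (g : G) : f (1 : G) (g⁻¹ : G) = f (g : G) (1 : G) := by
    rw [← hf g (1 : G)]
    simp
  rw [summable_iff_integrable_quotient, summable_iff_integrable_quotient]
  simp_rw [← h]
  exact ⟨fun hh => hh.comp_inv, fun hh => by simpa using hh.comp_inv⟩

/-- The mass transport principle for a unimodular group. -/
theorem tsum_transport (huni : IsUnimodular G) (O V : CompactOpenSubgroup G)
    [Countable (G ⧸ O.toSubgroup)] [Countable (G ⧸ V.toSubgroup)]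
    (f : G ⧸ O.toSubgroup → G ⧸ V.toSubgroup → ℝ)
    (hf : ∀ (g : G) x y, f (g • x) (g • y) = f x y) :
    V.vol * ∑' y, f (1 : G) y = O.vol * ∑' x, f x (1 : G) := by
  have := huni.isInvInvariant
  have h (g : G) : f (1 : G) (g⁻¹ : G) = f (g : G) (1 : G) := by
    rw [← hf g (1 : G)]
    simp
  rw [← integral_quotient, ← integral_quotient]
  simp_rw [← h]
  exact (integral_inv_eq_self (fun g : G => f (1 : G) (g : G)) Measure.haar).symm

end Transport

end Haar

/-! ### Equivariant operators on `ℓ²`-spaces -/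

section EllTwo

open scoped InnerProductSpace

/-- The real Hilbert space `ℓ²(X)`. -/
abbrev EllTwo (X : Type*) : Type _ := lp (fun _ : X => ℝ) 2

variable {X Y Z : Type*}

open Classical in
/-- The standard basis vector `δ_x`. -/
def delta (x : X) : EllTwo X := lp.single 2 x (1 : ℝ)

open Classical in
theorem delta_apply (x y : X) : delta x y = if y = x then (1 : ℝ) else 0 := by
  rw [delta, lp.single_apply, Pi.single_apply]

theorem inner_delta_left (x : X) (f : EllTwo X) : ⟪delta x, f⟫_ℝ = f x := by
  classical
  rw [delta, lp.inner_single_left]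
  simp

theorem inner_delta_right (x : X) (f : EllTwo X) : ⟪f, delta x⟫_ℝ = f x := by
  rw [real_inner_comm, inner_delta_left]

theorem norm_delta (x : X) : ‖delta x‖ = 1 := by
  classical
  rw [delta, lp.norm_single (by norm_num)]
  simp

theorem hasSum_inner_ellTwo (f h : EllTwo X) : HasSum (fun x => f x * h x) ⟪f, h⟫_ℝ := by
  simpa [mul_comm] using lp.hasSum_inner (𝕜 := ℝ) f h

theorem EllTwo.clm_ext {E : Type*} [NormedAddCommGroup E] [NormedSpace ℝ E]
    {A B : EllTwo X →L[ℝ] E} (h : ∀ x, A (delta x) = B (delta x)) : A = B := by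
  classical
  refine lp.ext_continuousLinearMap (by norm_num) fun x => ?_
  ext
  simpa [delta] using h x

theorem adjoint_delta_apply (A : EllTwo X →L[ℝ] EllTwo Y) (x : X) (y : Y) :
    A.adjoint (delta y) x = A (delta x) y := by
  rw [← inner_delta_left x, ContinuousLinearMap.adjoint_inner_right, inner_delta_right]

/-- Pairing `f` with the adjoint image of `delta z` gives the convergent matrix expansion of `B f`,
so operators are determined by, and can be computed from, their matrix entries. -/
theorem hasSum_comp_apply (B : EllTwo Y →L[ℝ] EllTwo Z) (f : EllTwo Y) (z : Z) :
    HasSum (fun y => f y * B (delta y) z) (B f z) := by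
  have h := hasSum_inner_ellTwo f (B.adjoint (delta z))
  simp_rw [adjoint_delta_apply] at h
  rwa [ContinuousLinearMap.adjoint_inner_right, inner_delta_right] at h

/-- Schur's test. -/
theorem exists_clm_of_kernel (K : Y → X → ℝ) (a b : ℝ) (ha : ∀ x (s : Finset Y), ∑ y ∈ s, |K y x| ≤ a)
    (hb : ∀ y (t : Finset X), ∑ x ∈ t, |K y x| ≤ b) :
    ∃ T : EllTwo X →L[ℝ] EllTwo Y, ∀ x y, T (delta x) y = K y x := by
  classical
  by_cases hY : IsEmpty Y
  · exact ⟨0, fun x y => hY.elim y⟩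
  obtain ⟨y₀⟩ := not_isEmpty_iff.1 hY
  by_cases hX : IsEmpty X
  · exact ⟨0, fun x y => hX.elim x⟩
  obtain ⟨x₀⟩ := not_isEmpty_iff.1 hX
  have ha0 : 0 ≤ a := by simpa using ha x₀ ∅
  have hb0 : 0 ≤ b := by simpa using hb y₀ ∅
  have hKb : ∀ y x, |K y x| ≤ b := fun y x => by simpa using hb y {x}
  have hmem : ∀ y, Memℓp (K y) 2 := fun y => by
    refine memℓp_gen' (C := b * b) fun t => ?_
    calc ∑ x ∈ t, ‖K y x‖ ^ (2 : ENNReal).toReal = ∑ x ∈ t, |K y x| * |K y x| := by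
          refine Finset.sum_congr rfl fun x _ => ?_
          simp [sq]
      _ ≤ ∑ x ∈ t, b * |K y x| := Finset.sum_le_sum fun x _ =>
          mul_le_mul_of_nonneg_right (hKb y x) (abs_nonneg _)
      _ ≤ b * b := by
          rw [← Finset.mul_sum]
          exact mul_le_mul_of_nonneg_left (hb y t) hb0
  let k : Y → EllTwo X := fun y => ⟨K y, hmem y⟩
  have hnorm : ∀ (f : EllTwo X) (s : Finset Y), ∑ y ∈ s, ⟪k y, f⟫_ℝ ^ 2 ≤ b * a * ‖f‖ ^ 2 := by
    intro f s
    have hlim : Filter.Tendsto (fun t : Finset X => ∑ y ∈ s, (∑ x ∈ t, K y x * f x) ^ 2)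
        Filter.atTop (nhds (∑ y ∈ s, ⟪k y, f⟫_ℝ ^ 2)) :=
      tendsto_finsetSum _ fun y _ => Filter.Tendsto.pow (hasSum_inner_ellTwo (k y) f) 2
    refine le_of_tendsto hlim (Filter.Eventually.of_forall fun t => ?_)
    have hf : ∑ x ∈ t, f x ^ 2 ≤ ‖f‖ ^ 2 := by
      have := lp.sum_rpow_le_norm_rpow (p := 2) (by norm_num) f t
      simpa using this
    -- Cauchy–Schwarz with `|K| = |K|^(1/2) · |K|^(1/2)`: one factor is bounded by the row sum `b`,
    -- the other is summed over `y` first and bounded by the column sum `a`.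
    calc ∑ y ∈ s, (∑ x ∈ t, K y x * f x) ^ 2
        ≤ ∑ y ∈ s, b * ∑ x ∈ t, |K y x| * f x ^ 2 := by
          refine Finset.sum_le_sum fun y _ => ?_
          refine (Finset.sum_sq_le_sum_mul_sum_of_sq_le_mul t (f := fun x => |K y x|)
            (g := fun x => |K y x| * f x ^ 2) (fun x _ => abs_nonneg _)
            (fun x _ => by positivity) fun x _ => le_of_eq ?_).trans
            (mul_le_mul_of_nonneg_right (hb y t) (Finset.sum_nonneg fun x _ => by positivity))
          rw [mul_pow, ← sq_abs (K y x)]; ring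
      _ = b * ∑ x ∈ t, (∑ y ∈ s, |K y x|) * f x ^ 2 := by
          rw [← Finset.mul_sum, Finset.sum_comm]
          simp_rw [Finset.sum_mul]
      _ ≤ b * ∑ x ∈ t, a * f x ^ 2 := by
          gcongr with x
          exact ha x s
      _ ≤ b * a * ‖f‖ ^ 2 := by
          rw [← Finset.mul_sum, ← mul_assoc]
          gcongr
  have hmem' : ∀ f : EllTwo X, Memℓp (fun y => ⟪k y, f⟫_ℝ) 2 := fun f =>
    memℓp_gen' (C := b * a * ‖f‖ ^ 2) fun s => by simpa using hnorm f s
  let T₀ : EllTwo X →ₗ[ℝ] EllTwo Y :=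
    { toFun := fun f => ⟨fun y => ⟪k y, f⟫_ℝ, hmem' f⟩
      map_add' := fun f h => by ext y; exact inner_add_right _ _ _
      map_smul' := fun c f => by ext y; exact inner_smul_right _ _ _ }
  -- The squared norm is bounded by `b * a`; the constant `b * a + 1` avoids a square root, since `t
  -- ≤ (t + 1) ^ 2` for `t ≥ 0`.
  refine ⟨T₀.mkContinuous (b * a + 1) fun f => ?_, fun x y => ?_⟩
  · refine lp.norm_le_of_forall_sum_le (by norm_num) (by positivity) fun s => ?_
    have h1 : ∑ i ∈ s, ‖T₀ f i‖ ^ (2 : ENNReal).toReal = ∑ y ∈ s, ⟪k y, f⟫_ℝ ^ 2 := by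
      refine Finset.sum_congr rfl fun y _ => ?_
      simp [T₀]
    rw [h1]
    refine (hnorm f s).trans ?_
    have h2 : b * a ≤ (b * a + 1) ^ 2 := by nlinarith [mul_nonneg hb0 ha0]
    have h3 : ((b * a + 1) * ‖f‖) ^ (2 : ENNReal).toReal = (b * a + 1) ^ 2 * ‖f‖ ^ 2 := by
      simp [mul_pow]
    rw [h3]
    gcongr
  · exact inner_delta_right x (k y)

section Action

variable {G : Type*} [Group G] [MulAction G X] [MulAction G Y] [MulAction G Z]

theorem memℓp_smul (g : G) (f : EllTwo X) : Memℓp (fun x => f (g • x)) 2 :=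
  memℓp_gen (((lp.memℓp f).summable (by norm_num)).comp_injective
    (i := fun x => g • x) (MulAction.injective g))

/-- The action of a group element on `ℓ²(X)`. -/
def translate (g : G) : EllTwo X →ₗ[ℝ] EllTwo X where
  toFun f := ⟨fun x => f (g⁻¹ • x), memℓp_smul g⁻¹ f⟩
  map_add' _ _ := rfl
  map_smul' _ _ := rfl

theorem translate_apply (g : G) (f : EllTwo X) (x : X) : translate g f x = f (g⁻¹ • x) := rfl

theorem translate_delta (g : G) (x : X) : translate g (delta x) = delta (g • x) := by
  classical
  ext y
  rw [translate_apply, delta_apply, delta_apply]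
  simp [inv_smul_eq_iff]

theorem inner_translate (g : G) (f h : EllTwo X) :
    ⟪translate g f, h⟫_ℝ = ⟪f, translate g⁻¹ h⟫_ℝ := by
  refine (hasSum_inner_ellTwo (translate g f) h).unique ?_
  rw [← (MulAction.toPerm g).hasSum_iff]
  convert hasSum_inner_ellTwo f (translate g⁻¹ h) using 2 with x
  simp [translate_apply]

variable (G) in
/-- Bounded operators commuting with the action of `G`. -/
def IsEquivariant (A : EllTwo X →L[ℝ] EllTwo Y) : Prop :=
  ∀ (g : G) f, A (translate g f) = translate g (A f)

theorem IsEquivariant.apply_smul {A : EllTwo X →L[ℝ] EllTwo Y} (hA : IsEquivariant G A) (g : G)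
    (x : X) (y : Y) : A (delta (g • x)) (g • y) = A (delta x) y := by
  rw [← translate_delta, hA, translate_apply, inv_smul_smul]

theorem isEquivariant_of_apply {A : EllTwo X →L[ℝ] EllTwo Y}
    (hA : ∀ (g : G) x y, A (delta (g • x)) (g • y) = A (delta x) y) : IsEquivariant G A := by
  intro g f
  ext y
  rw [translate_apply]
  refine (hasSum_comp_apply A (translate g f) y).unique ?_
  rw [← (MulAction.toPerm g).hasSum_iff]
  convert hasSum_comp_apply A f (g⁻¹ • y) using 2 with x
  rw [← hA g x (g⁻¹ • y), smul_inv_smul]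
  simp [translate_apply]

theorem IsEquivariant.comp {B : EllTwo Y →L[ℝ] EllTwo Z} {A : EllTwo X →L[ℝ] EllTwo Y}
    (hB : IsEquivariant G B) (hA : IsEquivariant G A) : IsEquivariant G (B ∘L A) := fun g f => by
  simp only [ContinuousLinearMap.comp_apply]
  rw [hA, hB]

theorem IsEquivariant.adjoint {A : EllTwo X →L[ℝ] EllTwo Y} (hA : IsEquivariant G A) :
    IsEquivariant G A.adjoint := isEquivariant_of_apply fun g y x => by
  rw [adjoint_delta_apply, adjoint_delta_apply, hA.apply_smul]

theorem IsEquivariant.sub {A B : EllTwo X →L[ℝ] EllTwo Y} (hA : IsEquivariant G A)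
    (hB : IsEquivariant G B) : IsEquivariant G (A - B) := fun g f => by
  simp only [sub_apply]
  rw [hA, hB, map_sub]

theorem IsEquivariant.smul {A : EllTwo X →L[ℝ] EllTwo Y} (hA : IsEquivariant G A) (c : ℝ) :
    IsEquivariant G (c • A) := fun g f => by
  simp only [smul_apply]
  rw [hA, map_smul]

theorem isEquivariant_one : IsEquivariant G (1 : EllTwo X →L[ℝ] EllTwo X) := fun _ _ => rfl

/-- The orthogonal projection to the orthogonal complement of the kernel is equivariant. -/
theorem IsEquivariant.starProjection_ker {A : EllTwo X →L[ℝ] EllTwo Y} (hA : IsEquivariant G A) :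
    IsEquivariant G (LinearMap.ker A.toLinearMap)ᗮ.starProjection := by
  intro g f
  set K := LinearMap.ker A.toLinearMap
  have hK (g : G) (v : EllTwo X) (hv : v ∈ K) : translate g v ∈ K := by
    have hv : A v = 0 := hv
    change A (translate g v) = 0
    rw [hA, hv, map_zero]
  have hKo (g : G) (v : EllTwo X) (hv : v ∈ Kᗮ) : translate g v ∈ Kᗮ := fun w hw => by
    rw [real_inner_comm, inner_translate, real_inner_comm]
    exact hv _ (hK _ _ hw)
  have : CompleteSpace K := (ContinuousLinearMap.isClosed_ker A).completeSpace_coe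
  refine Submodule.eq_starProjection_of_mem_orthogonal (hKo g _ (Submodule.coe_mem _)) ?_
  rw [← map_sub]
  refine fun w hw => ?_
  rw [real_inner_comm, inner_translate, real_inner_comm]
  have := hKo g⁻¹ w hw
  exact Submodule.sub_starProjection_mem_orthogonal f _ this

end Action

end EllTwo

/-! ### The trace of equivariant operators -/

section Trace

open scoped InnerProductSpace

/-- The `G`-set given by `n` disjoint copies of `G/O`. -/
abbrev Cosets {G : Type*} [Group G] [TopologicalSpace G] (O : CompactOpenSubgroup G) (n : ℕ) :
    Type _ := (_ : Fin n) × (G ⧸ O.toSubgroup)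

variable {G : Type*} [Group G] [TopologicalSpace G]

/-- The base points of the orbits in `n` copies of `G/O`. -/
def basePoint (O : CompactOpenSubgroup G) {n : ℕ} (k : Fin n) : Cosets O n := ⟨k, (1 : G)⟩

/-- The unnormalised trace of an equivariant operator. -/
def opTrace {O : CompactOpenSubgroup G} {n : ℕ}
    (A : EllTwo (Cosets O n) →L[ℝ] EllTwo (Cosets O n)) : ℝ :=
  ∑ k, A (delta (basePoint O k)) (basePoint O k)

/-- By symmetry `⟪C^(n+2) x, x⟫ = ⟪C^n (C x), C x⟫`, so induction goes in steps of two from the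
exponents 0 and 1. -/
theorem inner_pow_nonneg {E : Type*} [NormedAddCommGroup E] [InnerProductSpace ℝ E]
    (C : E →L[ℝ] E) (hC : ∀ x y, ⟪C x, y⟫_ℝ = ⟪x, C y⟫_ℝ) (hC0 : ∀ x, 0 ≤ ⟪C x, x⟫_ℝ) :
    ∀ (n : ℕ) (x : E), 0 ≤ ⟪(C ^ n) x, x⟫_ℝ
  | 0, x => real_inner_self_nonneg
  | 1, x => by simpa using hC0 x
  | n + 2, x => by
    have h : (C ^ (n + 2)) x = C ((C ^ n) (C x)) := by
      rw [show n + 2 = (1 + n) + 1 by omega, pow_succ, pow_add, pow_one]; rfl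
    rw [h, hC]
    exact inner_pow_nonneg C hC hC0 n (C x)

section Power

variable {G X Y : Type*} [Group G] [MulAction G X] [MulAction G Y]

/-- `W` is a polynomial in `S T`, and the same `W` serves both orders of composition. Thus `1 - (1 -
c T S)^N` and `1 - (1 - c S T)^N` are the products of `T` and `W S` in the two orders, and cyclicity
compares their traces. -/
theorem exists_pow_eq_one_sub (T : EllTwo X →L[ℝ] EllTwo Y) (hT : IsEquivariant G T)
    (S : EllTwo Y →L[ℝ] EllTwo X) (hS : IsEquivariant G S) (c : ℝ) (N : ℕ) :
    ∃ W : EllTwo X →L[ℝ] EllTwo X, IsEquivariant G W ∧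
      (1 - c • (T ∘L S)) ^ N = 1 - T ∘L (W ∘L S) ∧
      (1 - c • (S ∘L T)) ^ N = 1 - (W ∘L S) ∘L T := by
  induction N with
  | zero => exact ⟨0, fun g f => by simp, by simp, by simp⟩
  | succ N ih =>
    obtain ⟨W, hW, h1, h2⟩ := ih
    -- Read off from `(1 - T W S)(1 - c T S) = 1 - T (W + c - c W S T) S`.
    refine ⟨W + c • (1 - (W ∘L S) ∘L T), fun g f => ?_, ?_, ?_⟩
    · have h3 := (isEquivariant_one.sub ((hW.comp hS).comp hT)).smul c g f
      rw [add_apply, h3, hW, add_apply, map_add]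
    · rw [pow_succ, h1]
      ext1 x
      simp [smul_sub]
      abel
    · rw [pow_succ, h2]
      ext1 x
      simp [smul_sub]
      abel

end Power

variable [IsTopologicalGroup G]
  [LocallyCompactSpace G] [MeasurableSpace G] [BorelSpace G]

variable {O V : CompactOpenSubgroup G} {n m : ℕ}
  [Countable (G ⧸ O.toSubgroup)] [Countable (G ⧸ V.toSubgroup)]

/-- Mass transport for the invariant function `A_{yx} B_{xy}`, for each pair of orbits. The volumes
appear because `opTrace` is not normalised. -/
theorem opTrace_comp_comm (huni : IsUnimodular G)
    {A : EllTwo (Cosets O n) →L[ℝ] EllTwo (Cosets V m)} (hA : IsEquivariant G A)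
    {B : EllTwo (Cosets V m) →L[ℝ] EllTwo (Cosets O n)} (hB : IsEquivariant G B) :
    V.vol * opTrace (B ∘L A) = O.vol * opTrace (A ∘L B) := by
  let f (k : Fin n) (l : Fin m) (x : G ⧸ O.toSubgroup) (y : G ⧸ V.toSubgroup) : ℝ :=
    A (delta ⟨k, x⟩) ⟨l, y⟩ * B (delta ⟨l, y⟩) ⟨k, x⟩
  have hf (k l) (g : G) (x y) : f k l (g • x) (g • y) = f k l x y :=
    congrArg₂ (· * ·) (hA.apply_smul g ⟨k, x⟩ ⟨l, y⟩) (hB.apply_smul g ⟨l, y⟩ ⟨k, x⟩)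
  have h1 (k : Fin n) : (B ∘L A) (delta (basePoint O k)) (basePoint O k)
      = ∑ l, ∑' y, f k l (1 : G) y := by
    have h : HasSum (fun p : Cosets V m => f k p.1 (1 : G) p.2)
        ((B ∘L A) (delta (basePoint O k)) (basePoint O k)) :=
      hasSum_comp_apply B (A (delta (basePoint O k))) (basePoint O k)
    rw [← h.tsum_eq, h.summable.tsum_sigma, tsum_fintype]
  have h2 (l : Fin m) : (A ∘L B) (delta (basePoint V l)) (basePoint V l)
      = ∑ k, ∑' x, f k l x (1 : G) := by
    have h : HasSum (fun p : Cosets O n => f p.1 l p.2 (1 : G))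
        ((A ∘L B) (delta (basePoint V l)) (basePoint V l)) := by
      refine HasSum.congr_fun (hasSum_comp_apply A (B (delta (basePoint V l))) (basePoint V l)) ?_
      rintro ⟨k, x⟩
      exact mul_comm _ _
    rw [← h.tsum_eq, h.summable.tsum_sigma, tsum_fintype]
  simp_rw [opTrace, h1, h2, Finset.mul_sum, tsum_transport huni O V (f _ _) (hf _ _)]
  exact Finset.sum_comm

/-- The approximation step in the comparison of `L²`-dimensions: an operator factoring through an
idempotent `e` has an image of dimension at most the trace of `e`. -/
theorem opTrace_one_sub_pow_le (huni : IsUnimodular G)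
    {e : EllTwo (Cosets O n) →L[ℝ] EllTwo (Cosets O n)} (he : IsEquivariant G e)
    (hee : ∀ x, e (e x) = e x)
    {T : EllTwo (Cosets O n) →L[ℝ] EllTwo (Cosets V m)} (hT : IsEquivariant G T)
    (hTe : ∀ x, T (e x) = T x) (c : ℝ) (hc : 0 ≤ c) (hcT : c * ‖T‖ ^ 2 ≤ 1) (N : ℕ) :
    O.vol * opTrace (1 - (1 - c • (T ∘L T.adjoint)) ^ N) ≤ V.vol * opTrace e := by
  have hS : IsEquivariant G T.adjoint := hT.adjoint
  obtain ⟨W, hW, h1, h2⟩ := exists_pow_eq_one_sub T hT T.adjoint hS c N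
  set S := T.adjoint with hSdef
  set D := 1 - c • (S ∘L T) with hD
  have hD1 : (W ∘L S) ∘L T = 1 - D ^ N := by rw [h2, sub_sub_cancel]
  -- Cyclicity moves the trace from `1 - c T T*` on the target to `D = 1 - c T* T` on the source,
  -- where `e` acts.
  rw [h1, sub_sub_cancel, ← opTrace_comp_comm huni hT (hW.comp hS), hD1]
  refine mul_le_mul_of_nonneg_left ?_ V.vol_pos.le
  -- the projection `E` to the orthogonal complement of the kernel of `e` has the trace of `e`
  set K := LinearMap.ker e.toLinearMap with hK
  set E := Kᗮ.starProjection with hE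
  have hEeq : IsEquivariant G E := he.starProjection_ker
  have : CompleteSpace K := (ContinuousLinearMap.isClosed_ker e).completeSpace_coe
  have hker (x) : x - E x ∈ K := by
    have h := Submodule.sub_starProjection_mem_orthogonal (K := Kᗮ) x
    rwa [Submodule.orthogonal_orthogonal] at h
  have heE (x) : e (E x) = e x := by
    have h : e (x - E x) = 0 := hker x
    rw [map_sub, sub_eq_zero] at h
    exact h.symm
  have hEe (x) : E (e x) = E x := by
    have h : e x - x ∈ K := by
      change e (e x - x) = 0
      rw [map_sub, hee, sub_self]
    have h3 : E (e x - x) = 0 := by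
      rw [hE, Submodule.starProjection_apply_eq_zero_iff, Submodule.orthogonal_orthogonal]
      exact h
    rwa [map_sub, sub_eq_zero] at h3
  -- `e` and `E` are idempotents with the same kernel, so `E e = E` and `e E = e`; cyclicity equates
  -- their traces.
  have htr : opTrace e = opTrace E := by
    have h := opTrace_comp_comm huni he hEeq
    have h3 : E ∘L e = E := ContinuousLinearMap.ext hEe
    have h4 : e ∘L E = e := ContinuousLinearMap.ext heE
    rw [h3, h4] at h
    exact (mul_left_cancel₀ O.vol_pos.ne' h).symm
  rw [htr]
  refine Finset.sum_le_sum fun k _ => ?_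
  set b := delta (basePoint O k)
  have hTE (x) : T (E x) = T x := by rw [← hTe, heE, hTe]
  have hWE (x) : (1 - D ^ N) (E x) = (1 - D ^ N) x := by
    rw [← hD1]
    change W (S (T (E x))) = W (S (T x))
    rw [hTE]
  have hDsymm (x y) : ⟪D x, y⟫_ℝ = ⟪x, D y⟫_ℝ := by
    simp [hD, hSdef, inner_sub_left, inner_sub_right, inner_smul_left, inner_smul_right,
      ContinuousLinearMap.adjoint_inner_left, ContinuousLinearMap.adjoint_inner_right]
  have hDpos (x) : 0 ≤ ⟪D x, x⟫_ℝ := by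
    have h3 : ⟪D x, x⟫_ℝ = ‖x‖ ^ 2 - c * ‖T x‖ ^ 2 := by
      simp [hD, hSdef, inner_sub_left, inner_smul_left, ContinuousLinearMap.adjoint_inner_left]
    have h4 : ‖T x‖ ^ 2 ≤ ‖T‖ ^ 2 * ‖x‖ ^ 2 := by
      rw [← mul_pow]
      exact pow_le_pow_left₀ (norm_nonneg _) (T.le_opNorm x) 2
    rw [h3]
    nlinarith [mul_le_mul_of_nonneg_left h4 hc, sq_nonneg ‖x‖]
  have hpsymm (n : ℕ) (x y) : ⟪(D ^ n) x, y⟫_ℝ = ⟪x, (D ^ n) y⟫_ℝ := by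
    induction n generalizing x y with
    | zero => rfl
    | succ n ih =>
      have h3 : (D ^ (n + 1)) x = D ((D ^ n) x) := by rw [pow_succ']; rfl
      have h4 : (D ^ (n + 1)) y = (D ^ n) (D y) := by rw [pow_succ]; rfl
      rw [h3, h4, hDsymm, ih]
  -- `1 - D ^ N` is symmetric and unchanged by composing with `E`, so it only sees `E b`. Positivity
  -- of `D ^ N` then bounds the diagonal entry by `‖E b‖²`, the diagonal entry of `E`.
  have hQ : ⟪(1 - D ^ N) b, b⟫_ℝ = ⟪(1 - D ^ N) (E b), E b⟫_ℝ := by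
    have h3 (x y) : ⟪(1 - D ^ N) x, y⟫_ℝ = ⟪x, (1 - D ^ N) y⟫_ℝ := by
      rw [sub_apply, sub_apply, inner_sub_left, inner_sub_right, hpsymm]
      rfl
    rw [← hWE, h3, ← hWE b, ← h3]
  have hEb : E b (basePoint O k) = ⟪E b, E b⟫_ℝ := by
    rw [← inner_delta_right (basePoint O k) (E b)]
    have h3 : ⟪E b, b - E b⟫_ℝ = 0 := by
      have := hker b
      rw [real_inner_comm]
      exact (Submodule.coe_mem (Kᗮ.orthogonalProjectionOnto b)) _ this
    rw [inner_sub_right, sub_eq_zero] at h3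
    exact h3
  rw [hEb, ← inner_delta_right (basePoint O k), hQ, sub_apply, inner_sub_left]
  have := inner_pow_nonneg D hDsymm hDpos N (E b)
  simpa using this

/-- An idempotent through which an operator with image containing `δ_v - δ_w` factors, where `v` is
the base point of `G/V` and `w ≠ v`, has normalised trace at least `1/2`. -/
theorem half_le_opTrace (huni : IsUnimodular G)
    {e : EllTwo (Cosets O n) →L[ℝ] EllTwo (Cosets O n)} (he : IsEquivariant G e)
    (hee : ∀ x, e (e x) = e x)
    {T : EllTwo (Cosets O n) →L[ℝ] EllTwo (Cosets V 1)} (hT : IsEquivariant G T)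
    (hTe : ∀ x, T (e x) = T x) (w : Cosets V 1) (hw : w ≠ basePoint V 0)
    (v : EllTwo (Cosets O n)) (hv : T v = delta (basePoint V 0) - delta w) :
    1 / 2 * O.vol ≤ V.vol * opTrace e := by
  set δ : EllTwo (Cosets V 1) := delta (basePoint V 0)
  -- This is positive whatever `T` is, and satisfies `c * ‖T‖ ^ 2 ≤ 1`, which makes `C` a
  -- contraction.
  set c : ℝ := (‖T‖ ^ 2 + 1)⁻¹ with hcdef
  have hc : 0 < c := by positivity
  have hcT : c * ‖T‖ ^ 2 ≤ 1 := by
    rw [hcdef, inv_mul_le_iff₀ (by positivity)]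
    linarith
  set S := T.adjoint with hS
  set C := 1 - c • (T ∘L S) with hC
  have hCnorm : ‖C‖ ≤ 1 := by
    refine C.opNorm_le_bound zero_le_one fun x => ?_
    rw [one_mul]
    refine abs_le_of_sq_le_sq' ?_ (norm_nonneg _) |>.2
    have h1 : ‖C x‖ ^ 2 = ‖x‖ ^ 2 - 2 * (c * ‖S x‖ ^ 2) + c ^ 2 * ‖T (S x)‖ ^ 2 := by
      have h2 : C x = x - c • T (S x) := rfl
      have h3 : ⟪x, T (S x)⟫_ℝ = ‖S x‖ ^ 2 := by
        rw [← ContinuousLinearMap.adjoint_inner_left, ← hS, real_inner_self_eq_norm_sq]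
      rw [h2, norm_sub_sq_real, inner_smul_right, h3, norm_smul, mul_pow, Real.norm_eq_abs, sq_abs]
    have h4 : ‖T (S x)‖ ^ 2 ≤ ‖T‖ ^ 2 * ‖S x‖ ^ 2 := by
      rw [← mul_pow]
      exact pow_le_pow_left₀ (norm_nonneg _) (T.le_opNorm _) 2
    have h5 : c ^ 2 * ‖T (S x)‖ ^ 2 ≤ c * ‖S x‖ ^ 2 := by
      calc c ^ 2 * ‖T (S x)‖ ^ 2 ≤ c ^ 2 * (‖T‖ ^ 2 * ‖S x‖ ^ 2) := by gcongr
        _ = (c * ‖T‖ ^ 2) * (c * ‖S x‖ ^ 2) := by ring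
        _ ≤ 1 * (c * ‖S x‖ ^ 2) := by gcongr
        _ = _ := one_mul _
    have h6 : 0 ≤ c * ‖S x‖ ^ 2 := by positivity
    rw [h1]
    linarith
  have hδ : ⟪δ, δ⟫_ℝ = 1 := by rw [real_inner_self_eq_norm_sq, norm_delta, one_pow]
  have hδw : ⟪δ, delta w⟫_ℝ = 0 := by
    classical
    rw [inner_delta_left, delta_apply, if_neg hw.symm]
  have hpow (N : ℕ) : 1 - V.vol * opTrace e / O.vol ≤ ⟪(C ^ N) δ, δ⟫_ℝ := by
    have h := opTrace_one_sub_pow_le huni he hee hT hTe c hc.le hcT N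
    have h1 : opTrace (1 - C ^ N) = 1 - ⟪(C ^ N) δ, δ⟫_ℝ := by
      rw [opTrace, Fin.sum_univ_one, ← inner_delta_right (basePoint V 0), sub_apply,
        inner_sub_left]
      congr 1
    rw [h1, mul_comm, ← le_div_iff₀ O.vol_pos] at h
    linarith
  -- By the mean ergodic theorem the averages of `(C ^ k) δ` tend to the projection `z` of `δ` to
  -- the fixed vectors of `C`. These form the kernel of the adjoint of `T`, the orthogonal
  -- complement of its range. The lower bound `hpow` passes to averages and to the limit.
  set F := C.eqLocus (1 : EllTwo (Cosets V 1) →L[ℝ] EllTwo (Cosets V 1))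
  set z : EllTwo (Cosets V 1) := (F.orthogonalProjectionOnto δ).1 with hz
  have hlim : Filter.Tendsto (fun N => ⟪birkhoffAverage ℝ C _root_.id N δ, δ⟫_ℝ) Filter.atTop
      (nhds ⟪z, δ⟫_ℝ) :=
    (C.tendsto_birkhoffAverage_orthogonalProjection hCnorm δ).inner tendsto_const_nhds
  have hge : 1 - V.vol * opTrace e / O.vol ≤ ⟪z, δ⟫_ℝ := by
    -- `N = 0` is excluded because the empty average is 0 by convention.
    refine ge_of_tendsto hlim (Filter.eventually_atTop.2 ⟨1, fun N hN => ?_⟩)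
    have hN : (0 : ℝ) < N := by exact_mod_cast hN
    rw [birkhoffAverage, birkhoffSum, inner_smul_left, sum_inner, RCLike.conj_to_real,
      inv_mul_eq_div, le_div_iff₀ hN]
    calc (1 - V.vol * opTrace e / O.vol) * N
        = ∑ _k ∈ Finset.range N, (1 - V.vol * opTrace e / O.vol) := by
          rw [Finset.sum_const, Finset.card_range, nsmul_eq_mul, mul_comm]
      _ ≤ _ := Finset.sum_le_sum fun k _ => by
        have := hpow k
        rwa [show (C ^ k) δ = C^[k] δ from congrFun (FunLike.coe_pow_eq_iterate C k) δ] at this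
  have hzF : C z = z := (F.orthogonalProjectionOnto δ).2
  have hSz : S z = 0 := by
    have h1 : c • T (S z) = 0 := by
      have h2 : C z = z - c • T (S z) := rfl
      rw [hzF] at h2
      exact sub_eq_self.1 h2.symm
    have h2 : T (S z) = 0 := (smul_eq_zero.1 h1).resolve_left hc.ne'
    have h3 : ⟪S z, S z⟫_ℝ = 0 := by
      rw [hS, ContinuousLinearMap.adjoint_inner_left, ← hS, h2, inner_zero_right]
    exact inner_self_eq_zero.1 h3
  have hzw : ⟪z, δ⟫_ℝ = ⟪z, delta w⟫_ℝ := by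
    rw [← sub_eq_zero, ← inner_sub_right, ← hv, ← ContinuousLinearMap.adjoint_inner_left, ← hS,
      hSz, inner_zero_left]
  have hzz : ⟪z, δ⟫_ℝ = ⟪z, z⟫_ℝ := by
    have h := Submodule.sub_starProjection_mem_orthogonal (K := F) δ z
      (F.orthogonalProjectionOnto δ).2
    rw [inner_sub_right, sub_eq_zero] at h
    exact h
  have hle : ⟪z, δ⟫_ℝ ≤ 1 / 2 := by
    -- As `⟪z, δ⟫ = ⟪z, delta w⟫ = ‖z‖²` and `δ`, `delta w` are orthonormal, this square equals `1/2
    -- - ‖z‖²`. It is the source of the constant 1/2.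
    have h : 0 ≤ ⟪z - (1 / 2 : ℝ) • (δ + delta w), z - (1 / 2 : ℝ) • (δ + delta w)⟫_ℝ :=
      real_inner_self_nonneg
    have hww : ⟪delta w, delta w⟫_ℝ = 1 := by rw [real_inner_self_eq_norm_sq, norm_delta, one_pow]
    simp only [inner_sub_left, inner_sub_right, inner_smul_left, inner_smul_right, inner_add_left,
      inner_add_right, RCLike.conj_to_real, real_inner_comm z, real_inner_comm δ (delta w), hδ,
      hδw, hww, ← hzw, ← hzz] at h
    linarith
  have h1 : 1 / 2 ≤ V.vol * opTrace e / O.vol := by linarith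
  rwa [le_div_iff₀ O.vol_pos] at h1

end Trace

/-- By transitivity every row of an invariant kernel is a rearrangement of the row at `x₀`, so one
summable row gives the uniform bound that Schur's test needs. -/
theorem sum_le_tsum_of_invariant {G X Y : Type*} [Group G] [MulAction G X]
    [MulAction.IsPretransitive G X]
    [MulAction G Y] (f : X → Y → ℝ) (hf0 : ∀ x y, 0 ≤ f x y)
    (hf : ∀ (g : G) x y, f (g • x) (g • y) = f x y) (x₀ : X) (hs : Summable (f x₀))
    (x : X) (s : Finset Y) : ∑ y ∈ s, f x y ≤ ∑' y, f x₀ y := by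
  obtain ⟨g, rfl⟩ := MulAction.exists_smul_eq G x₀ x
  have h (y : Y) : f (g • x₀) y = f x₀ (MulAction.toPerm g⁻¹ y) := by
    rw [← hf g x₀]
    simp
  simp_rw [h]
  rw [← (MulAction.toPerm g⁻¹ : Equiv.Perm Y).tsum_eq (f x₀)]
  exact ((MulAction.toPerm g⁻¹ : Equiv.Perm Y).summable_iff.2 hs).sum_le_tsum s
    fun _ _ => hf0 _ _

/-! ### Intertwining maps of permutation modules -/

section Perm

variable {G : Type u} [Group G] [TopologicalSpace G]
  {O V W : CompactOpenSubgroup G}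

/-- The matrix entries of an intertwining map of transitive permutation modules. -/
def entry (α : (perm O).IntertwiningMap (perm V)) (x : G ⧸ O.toSubgroup)
    (y : G ⧸ V.toSubgroup) : ℚ :=
  (α (MonoidAlgebra.single x 1)).coeff y

theorem entry_smul (α : (perm O).IntertwiningMap (perm V)) (g : G) (x : G ⧸ O.toSubgroup)
    (y : G ⧸ V.toSubgroup) : entry α (g • x) (g • y) = entry α x y := by
  have h := Representation.IntertwiningMap.isIntertwining _ _ α g (MonoidAlgebra.single x 1)
  rw [Representation.ofMulAction_single] at h
  rw [entry, h, Representation.coeff_ofMulAction, inv_smul_smul]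
  rfl

theorem coeff_apply_eq_sum (α : (perm O).IntertwiningMap (perm V))
    (a : MonoidAlgebra ℚ (G ⧸ O.toSubgroup)) (y : G ⧸ V.toSubgroup) :
    (α a).coeff y = ∑ x ∈ a.coeff.support, a.coeff x * entry α x y := by
  conv_lhs => rw [← MonoidAlgebra.sum_coeff_single a, Finsupp.sum]
  rw [map_sum, MonoidAlgebra.coeff_sum, Finsupp.finsetSum_apply]
  refine Finset.sum_congr rfl fun x _ => ?_
  rw [show MonoidAlgebra.single x (a.coeff x) = a.coeff x • MonoidAlgebra.single x (1 : ℚ) by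
    rw [MonoidAlgebra.smul_single, smul_eq_mul, mul_one], map_smul]
  rfl

theorem hasSum_coeff_apply (α : (perm O).IntertwiningMap (perm V))
    (a : MonoidAlgebra ℚ (G ⧸ O.toSubgroup)) (y : G ⧸ V.toSubgroup) :
    HasSum (fun x => (a.coeff x : ℝ) * (entry α x y : ℝ)) ((α a).coeff y : ℝ) := by
  rw [coeff_apply_eq_sum]
  push_cast
  refine hasSum_sum_of_ne_finset_zero fun x hx => ?_
  rw [Finsupp.notMem_support_iff.1 hx, Rat.cast_zero, zero_mul]

theorem summable_entry (α : (perm O).IntertwiningMap (perm V)) (x : G ⧸ O.toSubgroup) :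
    Summable fun y => |(entry α x y : ℝ)| := by
  refine summable_of_ne_finset_zero (s := (α (MonoidAlgebra.single x 1)).coeff.support)
    fun y hy => ?_
  rw [entry, Finsupp.notMem_support_iff.1 hy, Rat.cast_zero, abs_zero]

/-- A tuple of elements of `ℚ[G/O]` as a vector of `ℓ²`. -/
def tupleVec {n : ℕ} (a : Fin n → MonoidAlgebra ℚ (G ⧸ O.toSubgroup)) : EllTwo (Cosets O n) :=
  ⟨fun p => ((a p.1).coeff p.2 : ℝ), by
    classical
    refine (memℓp_zero ?_).of_exponent_ge (zero_le)
    refine (Finset.univ.sigma fun k => (a k).coeff.support).finite_toSet.subset ?_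
    rintro ⟨k, x⟩ hx
    simpa using hx⟩

theorem tupleVec_apply {n : ℕ} (a : Fin n → MonoidAlgebra ℚ (G ⧸ O.toSubgroup)) (p : Cosets O n) :
    tupleVec a p = ((a p.1).coeff p.2 : ℝ) := rfl

theorem delta_eq_tupleVec {n : ℕ} (k : Fin n) (x : G ⧸ O.toSubgroup) :
    delta (⟨k, x⟩ : Cosets O n) = tupleVec (Pi.single k (MonoidAlgebra.single x 1)) := by
  classical
  ext ⟨l, y⟩
  rw [delta_apply, tupleVec_apply]
  by_cases h : l = k
  · subst h
    by_cases h2 : y = x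
    · subst h2
      simp
    · simp [h2]
  · simp [h]

theorem sum_sigma_le {X : Type*} {n : ℕ} (f : (_ : Fin n) × X → ℝ) (hf : ∀ p, 0 ≤ f p)
    (b : Fin n → ℝ) (hb : ∀ k (s : Finset X), ∑ x ∈ s, f ⟨k, x⟩ ≤ b k)
    (s : Finset ((_ : Fin n) × X)) : ∑ p ∈ s, f p ≤ ∑ k, b k := by
  classical
  calc ∑ p ∈ s, f p ≤ ∑ p ∈ Finset.univ.sigma fun _ => s.image Sigma.snd, f p :=
        Finset.sum_le_sum_of_subset_of_nonneg
          (fun p hp => by simpa using ⟨p.1, hp⟩) fun p _ _ => hf p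
    _ ≤ ∑ k, b k := by
        rw [Finset.sum_sigma]
        exact Finset.sum_le_sum fun k _ => hb k _

variable [IsTopologicalGroup G] [LocallyCompactSpace G] [MeasurableSpace G] [BorelSpace G]
  [Countable (G ⧸ O.toSubgroup)] [Countable (G ⧸ V.toSubgroup)]

/-- A matrix of intertwining maps of permutation modules extends to a bounded operator. -/
theorem exists_clm_of_matrix (huni : IsUnimodular G) {n m : ℕ}
    (α : Fin m → Fin n → (perm O).IntertwiningMap (perm V)) :
    ∃ T : EllTwo (Cosets O n) →L[ℝ] EllTwo (Cosets V m), IsEquivariant G T ∧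
      ∀ a, T (tupleVec a) = tupleVec fun l => ∑ k, α l k (a k) := by
  let f (l : Fin m) (k : Fin n) (x : G ⧸ O.toSubgroup) (y : G ⧸ V.toSubgroup) : ℝ :=
    |(entry (α l k) x y : ℝ)|
  have hf0 (l k x y) : 0 ≤ f l k x y := abs_nonneg _
  have hf (l k) (g : G) (x y) : f l k (g • x) (g • y) = f l k x y := by
    simp only [f, entry_smul]
  -- For a fixed source coset the entries have finite support. For a fixed target coset, summability
  -- is drawn from unimodularity through mass transport.
  have hs (l k) : Summable (f l k (1 : G)) := summable_entry _ _
  have hs' (l k) : Summable fun x => f l k x (1 : G) :=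
    (summable_transport huni O V (f l k) (hf l k)).1 (hs l k)
  let K (p : Cosets V m) (q : Cosets O n) : ℝ := (entry (α p.1 q.1) q.2 p.2 : ℝ)
  obtain ⟨T, hT⟩ := exists_clm_of_kernel K
    (∑ l, ∑ k, ∑' y, f l k (1 : G) y) (∑ k, ∑ l, ∑' x, f l k x (1 : G))
    (fun q s => sum_sigma_le _ (fun _ => abs_nonneg _) _ (fun l s =>
      (sum_le_tsum_of_invariant (f l q.1) (hf0 l q.1) (hf l q.1) _ (hs l q.1) q.2 s).trans
        (Finset.single_le_sum (f := fun k => ∑' y, f l k (1 : G) y)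
          (fun k _ => tsum_nonneg fun y => hf0 _ _ _ _) (Finset.mem_univ q.1))) s)
    (fun p s => sum_sigma_le _ (fun _ => abs_nonneg _) _ (fun k s =>
      (sum_le_tsum_of_invariant (fun y x => f p.1 k x y) (fun _ _ => hf0 _ _ _ _)
        (fun g y x => hf p.1 k g x y) _ (hs' p.1 k) p.2 s).trans
        (Finset.single_le_sum (f := fun l => ∑' x, f l k x (1 : G))
          (fun k _ => tsum_nonneg fun y => hf0 _ _ _ _) (Finset.mem_univ p.1))) s)
  refine ⟨T, isEquivariant_of_apply (G := G) fun g q p => ?_, fun a => ?_⟩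
  · rw [hT, hT]
    exact congrArg (fun c : ℚ => (c : ℝ)) (entry_smul (α p.1 q.1) g q.2 p.2)
  · ext ⟨l, y⟩
    have h := hasSum_comp_apply T (tupleVec a) ⟨l, y⟩
    simp_rw [hT] at h
    rw [← h.tsum_eq, h.summable.tsum_sigma, tsum_fintype, tupleVec_apply, MonoidAlgebra.coeff_sum,
      Finsupp.finsetSum_apply, Rat.cast_sum]
    exact Finset.sum_congr rfl fun k _ => (hasSum_coeff_apply (α l k) (a k) y).tsum_eq

theorem permTrace_comp_comm (huni : IsUnimodular G) (α : (perm O).IntertwiningMap (perm V))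
    (β : (perm V).IntertwiningMap (perm O)) :
    V.vol * (permTrace (β.comp α) : ℝ) = O.vol * (permTrace (α.comp β) : ℝ) := by
  have h1 := (hasSum_coeff_apply β (α (MonoidAlgebra.single ((1 : G) : G ⧸ O.toSubgroup) 1))
    (1 : G)).tsum_eq
  have h2 := (hasSum_coeff_apply α (β (MonoidAlgebra.single ((1 : G) : G ⧸ V.toSubgroup) 1))
    (1 : G)).tsum_eq
  rw [permTrace, permTrace, Representation.IntertwiningMap.comp_apply,
    Representation.IntertwiningMap.comp_apply, ← h1, ← h2]
  have h := tsum_transport huni O V (fun x y => (entry α x y : ℝ) * (entry β y x : ℝ))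
    (fun g x y => by rw [entry_smul, entry_smul])
  refine h.trans ?_
  congr 1
  exact tsum_congr fun x => mul_comm _ _

end Perm

/-! ### The trace of an endomorphism of a finitely generated projective module -/

section SplittingTrace

variable {G : Type u} [Group G] [TopologicalSpace G]

theorem permTrace_add {O : CompactOpenSubgroup G} (α β : (perm O).IntertwiningMap (perm O)) :
    permTrace (α + β) = permTrace α + permTrace β := rfl

theorem permTrace_sum {O : CompactOpenSubgroup G} {ι : Type*} (s : Finset ι)
    (α : ι → (perm O).IntertwiningMap (perm O)) :
    permTrace (∑ i ∈ s, α i) = ∑ i ∈ s, permTrace (α i) := by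
  rw [permTrace, IntertwiningMap.sum_apply, MonoidAlgebra.coeff_sum, Finsupp.finsetSum_apply]
  rfl

theorem Splitting.sum_r_i {P : Rep.{u} ℚ G} (s : Splitting P) (x : P) :
    ∑ j, s.r j (s.i j x) = x := by
  have h := congrArg (fun f => f x) s.sum_comp
  simpa [IntertwiningMap.sum_apply] using h

variable [IsTopologicalGroup G] [LocallyCompactSpace G] [MeasurableSpace G] [BorelSpace G]

/-- The real-valued Hattori–Stallings trace with respect to a presentation. -/
def Splitting.trace {P : Rep.{u} ℚ G} (s : Splitting P) (φ : P.ρ.IntertwiningMap P.ρ) : ℝ :=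
  s.O.vol⁻¹ * ((∑ j, permTrace ((s.i j).comp (φ.comp (s.r j))) : ℚ) : ℝ)

theorem Splitting.trace_add {P : Rep.{u} ℚ G} (s : Splitting P)
    (φ ψ : P.ρ.IntertwiningMap P.ρ) : s.trace (φ + ψ) = s.trace φ + s.trace ψ := by
  have h (j) : permTrace ((s.i j).comp ((φ + ψ).comp (s.r j))) =
      permTrace ((s.i j).comp (φ.comp (s.r j))) + permTrace ((s.i j).comp (ψ.comp (s.r j))) := by
    rw [← permTrace_add]
    congr 1
    exact DFunLike.ext _ _ fun x => map_add (s.i j) _ _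
  simp_rw [trace, h, Finset.sum_add_distrib, Rat.cast_add, mul_add]

theorem Splitting.coe_rank {P : Rep.{u} ℚ G} (s : Splitting P) :
    (s.rank : CompactlySupportedContinuousMap G ℝ →ₗ[ℝ] ℝ) =
      s.trace (IntertwiningMap.id P.ρ) • haarIntegral := by
  change (∑ j, permTrace ((s.i j).comp (s.r j))) • s.O.haarFunctional = _
  rw [s.O.haarFunctional_eq, trace]
  ext f
  simp only [LinearMap.smul_apply, Rat.smul_def, smul_eq_mul]
  rw [← mul_assoc, mul_comm (Rat.cast _)]
  rfl

/-- Inserting `∑ r i = id` in the middle reduces to maps between permutation modules. With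
identities for `φ` and `ψ` it compares two presentations of one module. -/
theorem Splitting.trace_comp_comm (hcg : IsCompactlyGenerated G) (huni : IsUnimodular G)
    {P Q : Rep.{u} ℚ G} (s : Splitting P) (t : Splitting Q)
    (φ : P.ρ.IntertwiningMap Q.ρ) (ψ : Q.ρ.IntertwiningMap P.ρ) :
    s.trace (ψ.comp φ) = t.trace (φ.comp ψ) := by
  have := countable_quotient hcg s.O
  have := countable_quotient hcg t.O
  have h1 (j) : (s.i j).comp ((ψ.comp φ).comp (s.r j)) =
      ∑ k, ((s.i j).comp (ψ.comp (t.r k))).comp ((t.i k).comp (φ.comp (s.r j))) := by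
    refine DFunLike.ext _ _ fun x => ?_
    simp only [IntertwiningMap.sum_apply,
      IntertwiningMap.comp_apply, ← map_sum, t.sum_r_i]
  have h2 (k) : (t.i k).comp ((φ.comp ψ).comp (t.r k)) =
      ∑ j, ((t.i k).comp (φ.comp (s.r j))).comp ((s.i j).comp (ψ.comp (t.r k))) := by
    refine DFunLike.ext _ _ fun x => ?_
    simp only [IntertwiningMap.sum_apply,
      IntertwiningMap.comp_apply, ← map_sum, s.sum_r_i]
  have h3 (j k) : s.O.vol⁻¹ * (permTrace (((s.i j).comp (ψ.comp (t.r k))).comp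
      ((t.i k).comp (φ.comp (s.r j)))) : ℝ) = t.O.vol⁻¹ * (permTrace
      (((t.i k).comp (φ.comp (s.r j))).comp ((s.i j).comp (ψ.comp (t.r k)))) : ℝ) := by
    have h := permTrace_comp_comm huni ((t.i k).comp (φ.comp (s.r j)))
      ((s.i j).comp (ψ.comp (t.r k)))
    have := s.O.vol_pos
    have := t.O.vol_pos
    field_simp
    linarith
  simp_rw [trace, h1, h2, permTrace_sum, Rat.cast_sum, Finset.mul_sum, h3]
  exact Finset.sum_comm

end SplittingTrace

section Inclusion

variable {k G V W : Type*} [CommRing k] [Group G] [AddCommGroup V] [Module k V]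
  [AddCommGroup W] [Module k W] {ρ : Representation k G V} {σ : Representation k G W}

/-- The inclusion of a subrepresentation. -/
def subrepIncl (S : Subrepresentation ρ) : S.toRepresentation.IntertwiningMap ρ where
  toLinearMap := S.toSubmodule.subtype
  isIntertwining' _ := rfl

theorem subrepIncl_injective (S : Subrepresentation ρ) : Function.Injective (subrepIncl S) :=
  Subtype.val_injective

end Inclusion

/-! ### The lower bound for the rank of an augmentation module -/

section LowerBound

variable {G : Type u} [Group G] [TopologicalSpace G]

theorem augmentation_apply (U : CompactOpenSubgroup G) (a : MonoidAlgebra ℚ (G ⧸ U.toSubgroup)) :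
    augmentation U a = a.coeff.sum fun _ c => c := by
  change Finsupp.linearCombination ℚ (fun _ : G ⧸ U.toSubgroup => (1 : ℚ)) a.coeff = _
  simp [Finsupp.linearCombination_apply]

theorem augmentation_single (U : CompactOpenSubgroup G) (x : G ⧸ U.toSubgroup) (c : ℚ) :
    augmentation U (MonoidAlgebra.single x c) = c := by
  rw [augmentation_apply, MonoidAlgebra.coeff_single, Finsupp.sum_single_index rfl]

/-- The element `xU - yU` of the augmentation module. -/
def augmentationDiff (U : CompactOpenSubgroup G) (x y : G ⧸ U.toSubgroup) :
    augmentationModule U :=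
  ⟨MonoidAlgebra.single x 1 - MonoidAlgebra.single y 1, by
    change augmentation U _ = 0
    rw [map_sub, augmentation_single, augmentation_single, sub_self]⟩

/-- The inclusion of the augmentation module. -/
def augmentationIncl (U : CompactOpenSubgroup G) :
    (augmentationModule U).ρ.IntertwiningMap (perm U) :=
  subrepIncl (augmentation U).ker

theorem augmentationIncl_diff (U : CompactOpenSubgroup G) (x y : G ⧸ U.toSubgroup) :
    augmentationIncl U (augmentationDiff U x y) =
      MonoidAlgebra.single x 1 - MonoidAlgebra.single y 1 := rfl

theorem half_le_trace_augmentationModule [IsTopologicalGroup G] [LocallyCompactSpace G]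
    [MeasurableSpace G] [BorelSpace G] (hcg : IsCompactlyGenerated G) (huni : IsUnimodular G)
    (U : CompactOpenSubgroup G) (hU : U.toSubgroup ≠ ⊤) (s : Splitting (augmentationModule U)) :
    1 / 2 * U.vol⁻¹ ≤ s.trace (IntertwiningMap.id _) := by
  have := countable_quotient hcg U
  have := countable_quotient hcg s.O
  obtain ⟨g, hg⟩ : ∃ g, g ∉ U.toSubgroup := by
    by_contra! h
    exact hU (eq_top_iff.2 fun g _ => h g)
  obtain ⟨e, he, hea⟩ := exists_clm_of_matrix huni fun j k => (s.i j).comp (s.r k)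
  obtain ⟨T, hT, hTa⟩ := exists_clm_of_matrix huni
    fun (_ : Fin 1) k => (augmentationIncl U).comp (s.r k)
  have hsum (a : Fin s.n → MonoidAlgebra ℚ (G ⧸ s.O.toSubgroup)) (j) :
      ∑ k, ((s.i j).comp (s.r k)) (a k) = s.i j (∑ k, s.r k (a k)) := by
    rw [map_sum]; rfl
  have hsumT (a : Fin s.n → MonoidAlgebra ℚ (G ⧸ s.O.toSubgroup)) :
      ∑ k, ((augmentationIncl U).comp (s.r k)) (a k) =
        augmentationIncl U (∑ k, s.r k (a k)) := by
    rw [map_sum]; rfl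
  simp_rw [hsum] at hea
  simp_rw [hsumT] at hTa
  have hee : e ∘L e = e := EllTwo.clm_ext fun ⟨k, x⟩ => by
    rw [delta_eq_tupleVec, ContinuousLinearMap.comp_apply, hea, hea]
    simp_rw [s.sum_r_i]
  have hTe : T ∘L e = T := EllTwo.clm_ext fun ⟨k, x⟩ => by
    rw [delta_eq_tupleVec, ContinuousLinearMap.comp_apply, hea, hTa, hTa]
    simp_rw [s.sum_r_i]
  -- Since `∑ r i = id`, the tuple of the `s.i j x` is sent by `T` to `x` itself, viewed in
  -- `ℓ²(G/U)`; this uses `g ∉ U` only to make the two cosets distinct.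
  let x := augmentationDiff U (1 : G) (g : G)
  have hv : T (tupleVec fun j => s.i j x) = delta (basePoint U 0) - delta ⟨0, (g : G)⟩ := by
    rw [hTa]
    simp_rw [s.sum_r_i]
    rw [augmentationIncl_diff, basePoint, delta_eq_tupleVec, delta_eq_tupleVec]
    ext ⟨l, y⟩
    obtain rfl := Subsingleton.elim l 0
    rw [lp.coeFn_sub, Pi.sub_apply]
    simp [tupleVec_apply]
  have key := half_le_opTrace huni he (fun x => congrArg (fun f => f x) hee) hT
    (fun x => congrArg (fun f => f x) hTe) ⟨0, (g : G)⟩ (fun h => hg (by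
      have h1 : ((g : G) : G ⧸ U.toSubgroup) = ((1 : G) : G ⧸ U.toSubgroup) := by
        simpa [basePoint] using h
      rw [eq_comm, QuotientGroup.eq] at h1
      simpa using h1)) _ hv
  have htr : opTrace e = ((∑ j, permTrace ((s.i j).comp (s.r j)) : ℚ) : ℝ) := by
    rw [opTrace, Rat.cast_sum]
    refine Finset.sum_congr rfl fun k _ => ?_
    rw [basePoint, delta_eq_tupleVec, hea, tupleVec_apply, permTrace, ← hsum,
      Finset.sum_eq_single k]
    · simp
    · intro l _ hl
      simp [hl]
    · simp
  rw [htr] at key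
  have h1 := U.vol_pos
  have h2 := s.O.vol_pos
  change _ ≤ s.O.vol⁻¹ * ((∑ j, permTrace ((s.i j).comp (s.r j)) : ℚ) : ℝ)
  field_simp
  field_simp at key
  linarith

end LowerBound

/-! ### Intertwining maps -/

section Intertwining

variable {k G V W X : Type*} [CommRing k] [Group G] [AddCommGroup V] [Module k V]
  [AddCommGroup W] [Module k W] [AddCommGroup X] [Module k X]
  {ρ : Representation k G V} {σ : Representation k G W} {τ : Representation k G X}

theorem intertwines (f : ρ.IntertwiningMap σ) (g : G) (v : V) : f (ρ g v) = σ g (f v) :=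
  IntertwiningMap.isIntertwining _ _ f g v

/-- A map killing the kernel of a surjection factors through it. -/
theorem exists_factor_of_surjective (f : ρ.IntertwiningMap σ) (hf : Function.Surjective f)
    (h : ρ.IntertwiningMap τ) (hh : ∀ v, f v = 0 → h v = 0) :
    ∃ l : σ.IntertwiningMap τ, ∀ v, l (f v) = h v := by
  have key (v v' : V) (hv : f v = f v') : h v = h v' := by
    rw [← sub_eq_zero, ← map_sub]
    exact hh _ (by rw [map_sub, hv, sub_self])
  choose s hs using hf
  refine ⟨⟨⟨⟨fun w => h (s w), fun w w' => ?_⟩, fun c w => ?_⟩, fun g => LinearMap.ext fun w => ?_⟩,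
    fun v => key _ _ (hs _)⟩
  · rw [← map_add]
    exact key _ _ (by rw [map_add, hs, hs, hs])
  · simp only [RingHom.id_apply]
    rw [← map_smul]
    exact key _ _ (by rw [map_smul, hs, hs])
  · change h (s (σ g w)) = τ g (h (s w))
    rw [← intertwines]
    exact key _ _ (by rw [intertwines, hs, hs])

/-- A map with image contained in that of an injection factors through it. -/
theorem exists_factor_of_injective (f : ρ.IntertwiningMap σ) (hf : Function.Injective f)
    (h : τ.IntertwiningMap σ) (hh : ∀ x, ∃ v, f v = h x) :
    ∃ l : τ.IntertwiningMap ρ, ∀ x, f (l x) = h x := by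
  choose s hs using hh
  refine ⟨⟨⟨⟨s, fun w w' => hf ?_⟩, fun c w => hf ?_⟩, fun g => LinearMap.ext fun w => hf ?_⟩, hs⟩
  · rw [map_add, hs, hs, hs, map_add]
  · rw [RingHom.id_apply, map_smul, hs, hs, map_smul]
  · change f (s (τ g w)) = f (ρ g (s w))
    rw [intertwines, hs, hs, intertwines]

/-- The quotient by the image of an intertwining map. -/
def cokerRep (f : ρ.IntertwiningMap σ) : Representation k G (W ⧸ LinearMap.range f.toLinearMap) :=
  σ.quotient _ fun g _ hw => f.range.apply_mem_toSubmodule g hw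

/-- The projection to the cokernel. -/
def cokerProj (f : ρ.IntertwiningMap σ) : σ.IntertwiningMap (cokerRep f) where
  toLinearMap := Submodule.mkQ _
  isIntertwining' _ := rfl

theorem cokerProj_surjective (f : ρ.IntertwiningMap σ) : Function.Surjective (cokerProj f) :=
  Submodule.mkQ_surjective _

theorem cokerProj_eq_zero_iff (f : ρ.IntertwiningMap σ) (w : W) :
    cokerProj f w = 0 ↔ ∃ v, f v = w :=
  Submodule.Quotient.mk_eq_zero _

end Intertwining

/-! ### Discrete modules -/

section Discrete

variable {G : Type u} [Group G] [TopologicalSpace G]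
  {V W : Type*} [AddCommGroup V] [Module ℚ V] [AddCommGroup W] [Module ℚ W]
  {ρ : Representation ℚ G V} {σ : Representation ℚ G W}

/-- The stabiliser of an element of a representation. -/
def repStab (ρ : Representation ℚ G V) (v : V) : Subgroup G where
  carrier := {g | ρ g v = v}
  one_mem' := by simp
  mul_mem' {a b} ha hb := by
    change ρ (a * b) v = v
    rw [map_mul, Module.End.mul_apply, show ρ b v = v from hb, show ρ a v = v from ha]
  inv_mem' {a} ha := by
    change ρ a⁻¹ v = v
    conv_lhs => rw [← show ρ a v = v from ha]
    rw [Representation.inv_self_apply]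

omit [TopologicalSpace G] in
theorem mem_repStab {v : V} {g : G} : g ∈ repStab ρ v ↔ ρ g v = v := Iff.rfl

theorem isOpen_repStab [IsTopologicalGroup G] {v : V} (S : Subgroup G) (hS : IsOpen (S : Set G))
    (h : ∀ g ∈ S, ρ g v = v) : IsOpen {g : G | ρ g v = v} :=
  Subgroup.isOpen_mono (H₁ := S) (H₂ := repStab ρ v) (fun g hg => h g hg) hS

theorem IsDiscrete.of_injective (hσ : IsDiscrete σ) (f : ρ.IntertwiningMap σ)
    (hf : Function.Injective f) : IsDiscrete ρ := fun v => by
  have : {g : G | ρ g v = v} = {g : G | σ g (f v) = f v} := by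
    ext g
    change ρ g v = v ↔ σ g (f v) = f v
    rw [← intertwines, hf.eq_iff]
  rw [this]
  exact hσ _

theorem IsDiscrete.of_surjective [IsTopologicalGroup G] (hρ : IsDiscrete ρ)
    (f : ρ.IntertwiningMap σ) (hf : Function.Surjective f) : IsDiscrete σ := fun w => by
  obtain ⟨v, rfl⟩ := hf w
  refine isOpen_repStab (repStab ρ v) (hρ v) fun g hg => ?_
  rw [← intertwines, mem_repStab.1 hg]

theorem IsDiscrete.cokerRep [IsTopologicalGroup G] (hσ : IsDiscrete σ)
    (f : ρ.IntertwiningMap σ) : IsDiscrete (cokerRep f) :=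
  hσ.of_surjective (cokerProj f) (cokerProj_surjective f)

theorem isDiscrete_trivial : IsDiscrete (Representation.trivial ℚ G V) := fun v => by
  simp

/-! ### Coinduced modules and injective resolutions -/

/-- The functions `G → V` invariant under right translation by an open subgroup. -/
def smoothFunctions (G : Type u) [Group G] [TopologicalSpace G] (V : Type u) [AddCommGroup V]
    [Module ℚ V] : Submodule ℚ (G → V) where
  carrier := {f | ∃ S : Subgroup G, IsOpen (S : Set G) ∧ ∀ s ∈ S, ∀ x, f (x * s) = f x}
  add_mem' := by
    rintro f h ⟨S, hS, hf⟩ ⟨T, hT, hh⟩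
    refine ⟨S ⊓ T, hS.inter hT, fun s hs x => ?_⟩
    rw [Pi.add_apply, Pi.add_apply, hf s hs.1, hh s hs.2]
  zero_mem' := ⟨⊤, isOpen_univ, fun _ _ _ => rfl⟩
  smul_mem' := by
    rintro c f ⟨S, hS, hf⟩
    exact ⟨S, hS, fun s hs x => by rw [Pi.smul_apply, Pi.smul_apply, hf s hs]⟩

end Discrete

section Coinduced

variable {G : Type u} [Group G] [TopologicalSpace G]
  {V : Type u} [AddCommGroup V] [Module ℚ V] {ρ : Representation ℚ G V}

variable (G V) in
/-- The coinduced module of a vector space, with `G` acting by right translation. -/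
def coindRep [IsTopologicalGroup G] : Representation ℚ G (smoothFunctions G V) where
  toFun g :=
    { toFun := fun f => ⟨fun x => f.1 (x * g), by
        obtain ⟨S, hS, hf⟩ := f.2
        refine ⟨S.map (MulAut.conj g).toMonoidHom, ?_, ?_⟩
        · have : ((S.map (MulAut.conj g).toMonoidHom : Subgroup G) : Set G)
              = (fun x => g⁻¹ * x * g) ⁻¹' S := by
            ext x
            simp only [Subgroup.coe_map, Set.mem_image, Set.mem_preimage, SetLike.mem_coe]
            constructor
            · rintro ⟨s, hs, rfl⟩
              simpa [mul_assoc] using hs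
            · intro hx
              exact ⟨_, hx, by simp [mul_assoc]⟩
          rw [this]
          exact hS.preimage (by fun_prop)
        · rintro _ ⟨s, hs, rfl⟩ x
          have : x * (MulAut.conj g).toMonoidHom s * g = x * g * s := by simp [mul_assoc]
          change f.1 (x * _ * g) = _
          rw [this, hf s hs]⟩
      map_add' := fun _ _ => rfl
      map_smul' := fun _ _ => rfl }
  map_one' := by ext f x; simp
  map_mul' g h := by ext f x; simp [mul_assoc]

theorem coindRep_apply [IsTopologicalGroup G] (g : G) (f : smoothFunctions G V) (x : G) :
    (coindRep G V g f).1 x = f.1 (x * g) := rfl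

theorem isDiscrete_coindRep [IsTopologicalGroup G] : IsDiscrete (coindRep G V) := fun f => by
  obtain ⟨S, hS, hf⟩ := f.2
  exact isOpen_repStab S hS fun g hg => Subtype.ext (funext fun x => hf g hg x)

/-- The map to a coinduced module defined by a linear map. -/
def toCoind [IsTopologicalGroup G] {A : Type*} [AddCommGroup A] [Module ℚ A]
    {α : Representation ℚ G A} (hα : IsDiscrete α) (l : A →ₗ[ℚ] V) :
    α.IntertwiningMap (coindRep G V) where
  toFun a := ⟨fun x => l (α x a), repStab α a, hα a, fun s hs x => by
    change l (α (x * s) a) = l (α x a)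
    rw [map_mul, Module.End.mul_apply, mem_repStab.1 hs]⟩
  map_add' a b := by ext x; simp
  map_smul' c a := by ext x; simp
  isIntertwining' g := by ext a x; simp [coindRep_apply]

theorem toCoind_apply [IsTopologicalGroup G] {A : Type*} [AddCommGroup A] [Module ℚ A]
    {α : Representation ℚ G A} (hα : IsDiscrete α) (l : A →ₗ[ℚ] V) (a : A) (x : G) :
    (toCoind hα l a).1 x = l (α x a) := rfl

/-- Frobenius reciprocity: a map to a coinduced module is recovered from its value at `1`, which is
merely `ℚ`-linear and so extends along any injection. -/
theorem exists_extend_coind [IsTopologicalGroup G] {A B : Type*} [AddCommGroup A] [Module ℚ A]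
    [AddCommGroup B] [Module ℚ B] {α : Representation ℚ G A} {β : Representation ℚ G B}
    (hβ : IsDiscrete β) (f : α.IntertwiningMap β) (hf : Function.Injective f)
    (h : α.IntertwiningMap (coindRep G V)) :
    ∃ k : β.IntertwiningMap (coindRep G V), ∀ a, k (f a) = h a := by
  obtain ⟨r, hr⟩ := LinearMap.exists_leftInverse_of_injective f.toLinearMap
    (LinearMap.ker_eq_bot.2 hf)
  have hr' (a) : r (f a) = a := congrArg (fun l => l a) hr
  let l : A →ₗ[ℚ] V := LinearMap.proj (1 : G) ∘ₗ (smoothFunctions G V).subtype ∘ₗ h.toLinearMap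
  refine ⟨toCoind hβ (l ∘ₗ r), fun a => Subtype.ext (funext fun x => ?_)⟩
  rw [toCoind_apply, LinearMap.comp_apply, ← intertwines, hr']
  change (h (α x a)).1 1 = _
  rw [intertwines, coindRep_apply, one_mul]

theorem isInjective_coind [IsTopologicalGroup G] : IsInjective (Rep.of (coindRep G V)) :=
  ⟨isDiscrete_coindRep, fun _ _ _ hB f g hf => by
    obtain ⟨k, hk⟩ := exists_extend_coind hB f hf g
    exact ⟨k, DFunLike.ext _ _ hk⟩⟩

/-- The embedding of a discrete module into a coinduced module. -/
def coindEmb [IsTopologicalGroup G] (hρ : IsDiscrete ρ) : ρ.IntertwiningMap (coindRep G V) :=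
  toCoind hρ LinearMap.id

theorem coindEmb_injective [IsTopologicalGroup G] (hρ : IsDiscrete ρ) :
    Function.Injective (coindEmb hρ) := fun v w h => by
  have h1 := congrFun (congrArg Subtype.val h) 1
  simpa [coindEmb, toCoind_apply] using h1

variable (G) in
/-- Discrete modules, bundled. -/
abbrev DiscreteRep : Type (u + 1) := {M : Rep.{u} ℚ G // IsDiscrete M.ρ}

variable [IsTopologicalGroup G]

/-- The embedding of a discrete module into its coinduced module. -/
def DiscreteRep.emb (M : DiscreteRep G) : M.1.ρ.IntertwiningMap (coindRep G M.1.V) :=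
  coindEmb M.2

/-- The first cosyzygy of a discrete module. -/
def DiscreteRep.cosyzygy (M : DiscreteRep G) : DiscreteRep G :=
  ⟨Rep.of (cokerRep M.emb), isDiscrete_coindRep.cokerRep _⟩

/-- The projection of the coinduced module to the cosyzygy. -/
def DiscreteRep.proj (M : DiscreteRep G) :
    (coindRep G M.1.V).IntertwiningMap M.cosyzygy.1.ρ :=
  cokerProj M.emb

theorem DiscreteRep.emb_injective (M : DiscreteRep G) : Function.Injective M.emb :=
  coindEmb_injective M.2

theorem DiscreteRep.proj_surjective (M : DiscreteRep G) : Function.Surjective M.proj :=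
  cokerProj_surjective _

theorem DiscreteRep.proj_eq_zero_iff (M : DiscreteRep G) (x) : M.proj x = 0 ↔ ∃ v, M.emb v = x :=
  cokerProj_eq_zero_iff _ _

/-- The iterated cosyzygies of a discrete module. -/
def DiscreteRep.iterCosyzygy (M : DiscreteRep G) : ℕ → DiscreteRep G
  | 0 => M
  | n + 1 => (M.iterCosyzygy n).cosyzygy

/-- The injective resolution by coinduced modules. -/
def coindResolution (M : DiscreteRep G) : InjectiveResolution M.1 where
  I n := Rep.of (coindRep G (M.iterCosyzygy n).1.V)
  injective n := isInjective_coind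
  ι := M.emb
  d n := (M.iterCosyzygy (n + 1)).emb.comp (M.iterCosyzygy n).proj
  ι_injective := M.emb_injective
  exact_zero x := (map_eq_zero_iff _ (M.iterCosyzygy 1).emb_injective).trans
    (M.proj_eq_zero_iff x)
  exact_succ n x := by
    refine (map_eq_zero_iff _ (M.iterCosyzygy (n + 2)).emb_injective).trans ?_
    refine ((M.iterCosyzygy (n + 1)).proj_eq_zero_iff x).trans ⟨?_, ?_⟩
    · rintro ⟨v, rfl⟩
      obtain ⟨y, rfl⟩ := (M.iterCosyzygy n).proj_surjective v
      exact ⟨y, rfl⟩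
    · rintro ⟨y, rfl⟩
      exact ⟨_, rfl⟩

/-- If `cd_ℚ(G) ≤ 1`, then invariants lift along the projection to a second cosyzygy. -/
theorem exists_invariant_lift (hcd : cdQ G ≤ 1) (M : DiscreteRep G)
    (c : M.cosyzygy.cosyzygy.1) (hc : ∀ g, M.cosyzygy.cosyzygy.1.ρ g c = c) :
    ∃ y, (∀ g, coindRep G _ g y = y) ∧ M.cosyzygy.proj y = c := by
  let R := coindResolution M
  have hR : Subsingleton (R.dH 2) := by
    by_contra h
    rw [not_subsingleton_iff_nontrivial] at h
    have h2 : (2 : ℕ∞) ≤ cdQ G := le_sSup ⟨2, rfl, M.1, M.2, R, h⟩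
    exact absurd (h2.trans hcd) (by decide)
  -- The vector `c`, embedded in `I²`, is an invariant cocycle. Vanishing of `dH²` gives an
  -- invariant `y` in `I¹` with `emb (proj y) = emb c`.
  let x : (R.I 2).ρ.invariants := ⟨M.cosyzygy.cosyzygy.emb c, fun g =>
    (intertwines M.cosyzygy.cosyzygy.emb g c).symm.trans (congrArg _ (hc g))⟩
  have hx : x ∈ LinearMap.ker (R.dInvariants 2) := by
    refine Subtype.ext ?_
    change M.cosyzygy.cosyzygy.cosyzygy.emb
      (M.cosyzygy.cosyzygy.proj (M.cosyzygy.cosyzygy.emb c)) = 0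
    rw [(M.cosyzygy.cosyzygy.proj_eq_zero_iff _).2 ⟨c, rfl⟩, map_zero]
  have h0 : Submodule.Quotient.mk (p := (R.coboundaries 2).comap
      (LinearMap.ker (R.dInvariants 2)).subtype) ⟨x, hx⟩ = 0 := Subsingleton.elim _ _
  rw [Submodule.Quotient.mk_eq_zero] at h0
  obtain ⟨y, hy⟩ : ∃ y, R.dInvariants 1 y = x := h0
  refine ⟨y.1, y.2, M.cosyzygy.cosyzygy.emb_injective ?_⟩
  exact congrArg Subtype.val hy

/-- Over a group with `cd_ℚ(G) ≤ 1`, the kernel of a map from a projective discrete module onto the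
trivial module is projective. -/
theorem isProjective_ker (hcd : cdQ G ≤ 1) (F : Rep.{u} ℚ G) (hF : IsProjective F)
    (ε : F.ρ.IntertwiningMap (Representation.trivial ℚ G ℚ)) (hε : Function.Surjective ε) :
    IsProjective (Rep.of ε.ker.toRepresentation) := by
  refine ⟨hF.1.of_injective (subrepIncl ε.ker) (subrepIncl_injective _), ?_⟩
  intro A B hA hB f g hf
  let N : Rep.{u} ℚ G := Rep.of ε.ker.toRepresentation
  let incl : N.ρ.IntertwiningMap F.ρ := subrepIncl ε.ker
  have hincl (n : N) : ε (incl n) = 0 := n.2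
  let K : DiscreteRep G := ⟨Rep.of f.ker.toRepresentation,
    hA.of_injective (subrepIncl f.ker) (subrepIncl_injective _)⟩
  -- `a` and the induced `β` make `A` the pullback of `B` and the coinduced module of `K` over the
  -- cosyzygy. Lifting `g` through `f` thus amounts to lifting `φ = β g` through `K.proj`.
  obtain ⟨a, ha⟩ := exists_extend_coind hA (subrepIncl f.ker) (subrepIncl_injective _) K.emb
  obtain ⟨β, hβ⟩ := exists_factor_of_surjective f hf (K.proj.comp a) fun v hv =>
    (K.proj_eq_zero_iff _).2 ⟨⟨v, hv⟩, (ha ⟨v, hv⟩).symm⟩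
  let φ := β.comp g
  -- The obstruction to extending `φ` from the kernel to `F` is the invariant vector `χ 1` in the
  -- second cosyzygy. Lifting it to an invariant `y` allows the correction `ψ - ε • y`, which takes
  -- values in the first cosyzygy and still restricts to `φ`.
  obtain ⟨ψ, hψ⟩ := exists_extend_coind hF.1 incl (subrepIncl_injective _)
    (K.cosyzygy.emb.comp φ)
  obtain ⟨χ, hχ⟩ := exists_factor_of_surjective ε hε (K.cosyzygy.proj.comp ψ) fun v hv =>
    (K.cosyzygy.proj_eq_zero_iff _).2 ⟨φ ⟨v, hv⟩, (hψ ⟨v, hv⟩).symm⟩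
  obtain ⟨y, hy, hyc⟩ := exists_invariant_lift hcd K (χ 1) fun g => by
    rw [← intertwines]; rfl
  obtain ⟨ψ', hψ'⟩ := exists_factor_of_injective K.cosyzygy.emb K.cosyzygy.emb_injective
    (⟨ψ.toLinearMap - ε.toLinearMap.smulRight y, fun g => LinearMap.ext fun x => by
      change ψ (F.ρ g x) - ε (F.ρ g x) • y = coindRep G _ g (ψ x - ε x • y)
      rw [intertwines, intertwines, map_sub, map_smul, hy]
      rfl⟩ : F.ρ.IntertwiningMap (coindRep G K.cosyzygy.1.V)) fun x => by
      refine (K.cosyzygy.proj_eq_zero_iff _).1 ?_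
      change K.cosyzygy.proj (ψ x - ε x • y) = 0
      have h1 : K.cosyzygy.proj (ψ x) = χ (ε x) := (hχ x).symm
      rw [map_sub, map_smul, hyc, h1, ← map_smul, smul_eq_mul, mul_one, sub_self]
  have hψφ (n : N) : ψ' (incl n) = φ n := by
    refine K.cosyzygy.emb_injective ((hψ' _).trans ?_)
    change ψ (incl n) - ε (incl n) • y = _
    rw [hincl, zero_smul, sub_zero]
    exact hψ n
  -- With `φ` extended to `F` as `ψ'`, projectivity of `F` lifts it to the coinduced module.
  obtain ⟨l, hl⟩ := hF.2 (Rep.of (coindRep G K.1.V)) K.cosyzygy.1 isDiscrete_coindRep K.cosyzygy.2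
    K.proj ψ' K.proj_surjective
  have hl (x) : K.proj (l x) = ψ' x := congrArg (fun f => f x) hl
  -- The pullback property: `(f, a)` is injective, and its image contains each pair `(g n, l n)`
  -- because the two components agree in the cosyzygy.
  obtain ⟨h, hh⟩ := exists_factor_of_injective (f.prod a) (fun x x' hxx => by
    have h1 : f x = f x' := congrArg Prod.fst hxx
    have h2 : a x = a x' := congrArg Prod.snd hxx
    rw [← sub_eq_zero, ← map_sub] at h1 h2
    have h3 : K.emb ⟨x - x', h1⟩ = 0 := (ha ⟨x - x', h1⟩).symm.trans h2
    rw [map_eq_zero_iff _ K.emb_injective] at h3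
    exact sub_eq_zero.1 (congrArg Subtype.val h3)) (g.prod (l.comp incl)) fun n => by
    obtain ⟨x, hx⟩ := hf (g n)
    have h1 : K.proj (l (incl n) - a x) = 0 := by
      have h2 : K.proj (a x) = β (f x) := (hβ x).symm
      rw [map_sub, hl, hψφ, h2, hx]
      exact sub_self _
    obtain ⟨k, hk⟩ := (K.proj_eq_zero_iff _).1 h1
    refine ⟨x + subrepIncl f.ker k, Prod.ext ?_ ?_⟩
    · change f (x + subrepIncl f.ker k) = g n
      have h3 : f (subrepIncl f.ker k) = 0 := k.2
      rw [map_add, hx, h3, add_zero]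
    · change a (x + subrepIncl f.ker k) = l (incl n)
      rw [map_add, ha, hk, add_sub_cancel]
  exact ⟨h, DFunLike.ext _ _ fun n => congrArg Prod.fst (hh n)⟩

end Coinduced

/-! ### Projective permutation modules -/

section PermModules

variable {G : Type u} [Group G] [TopologicalSpace G]

section

variable {V : Type*} [AddCommGroup V] [Module ℚ V] {ρ : Representation ℚ G V}

/-- An element fixed by `O` defines a map from `ℚ[G/O]`. -/
theorem exists_perm_lift (O : CompactOpenSubgroup G) (v : V) (hv : ∀ g ∈ O.toSubgroup, ρ g v = v) :
    ∃ f : (perm O).IntertwiningMap ρ, ∀ g : G, f (MonoidAlgebra.single (g : G ⧸ O.toSubgroup) 1) =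
      ρ g v := by
  let t : G ⧸ O.toSubgroup → V := fun x => Quotient.liftOn' x (fun g => ρ g v) fun a b hab => by
    rw [QuotientGroup.leftRel_apply] at hab
    rw [← mul_inv_cancel_left a b, map_mul, Module.End.mul_apply, hv _ hab]
  have ht (g : G) : t (g : G ⧸ O.toSubgroup) = ρ g v := rfl
  let l : MonoidAlgebra ℚ (G ⧸ O.toSubgroup) →ₗ[ℚ] V :=
    Finsupp.linearCombination ℚ t ∘ₗ (MonoidAlgebra.coeffLinearEquiv ℚ).toLinearMap
  have hl (x) : l (MonoidAlgebra.single x 1) = t x := by simp [l]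
  refine ⟨⟨l, fun g => ?_⟩, fun g => (hl _).trans (ht g)⟩
  refine MonoidAlgebra.lhom_ext' fun x => LinearMap.ext_ring ?_
  induction x using QuotientGroup.induction_on with
  | H h =>
    change l (perm O g (MonoidAlgebra.single _ 1)) = ρ g (l (MonoidAlgebra.single _ 1))
    rw [Representation.ofMulAction_single, hl, hl, ht, MulAction.Quotient.smul_coe, ht,
      smul_eq_mul, map_mul, Module.End.mul_apply]

theorem perm_hom_ext {O : CompactOpenSubgroup G} {f f' : (perm O).IntertwiningMap ρ}
    (h : f (MonoidAlgebra.single ((1 : G) : G ⧸ O.toSubgroup) 1) =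
      f' (MonoidAlgebra.single ((1 : G) : G ⧸ O.toSubgroup) 1)) : f = f' := by
  refine IntertwiningMap.ext (MonoidAlgebra.lhom_ext' fun x => LinearMap.ext_ring ?_)
  change f (MonoidAlgebra.single x 1) = f' (MonoidAlgebra.single x 1)
  induction x using QuotientGroup.induction_on with
  | H g =>
    have hg : MonoidAlgebra.single (g : G ⧸ O.toSubgroup) (1 : ℚ) =
        perm O g (MonoidAlgebra.single ((1 : G) : G ⧸ O.toSubgroup) 1) := by
      rw [Representation.ofMulAction_single, MulAction.Quotient.smul_coe, smul_eq_mul, mul_one]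
    rw [hg, intertwines, intertwines, h]

theorem perm_single_one_fixed (O : CompactOpenSubgroup G) {g : G} (hg : g ∈ O.toSubgroup) :
    perm O g (MonoidAlgebra.single ((1 : G) : G ⧸ O.toSubgroup) 1) =
      MonoidAlgebra.single ((1 : G) : G ⧸ O.toSubgroup) 1 := by
  rw [Representation.ofMulAction_single, MulAction.Quotient.smul_coe, smul_eq_mul, mul_one,
    show ((g : G) : G ⧸ O.toSubgroup) = ((1 : G) : G ⧸ O.toSubgroup) by
      rw [eq_comm, QuotientGroup.eq]; simpa using hg]

/-- Averaging over a compact open subgroup. -/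
theorem exists_fixed_lift [IsTopologicalGroup G] {W : Type*} [AddCommGroup W] [Module ℚ W]
    {σ : Representation ℚ G W} (hρ : IsDiscrete ρ) (O : CompactOpenSubgroup G)
    (f : ρ.IntertwiningMap σ) (hf : Function.Surjective f)
    (w : W) (hw : ∀ g ∈ O.toSubgroup, σ g w = w) :
    ∃ v, f v = w ∧ ∀ g ∈ O.toSubgroup, ρ g v = v := by
  classical
  obtain ⟨v, hv⟩ := hf w
  let Ω : Set V := (fun g => ρ g v) '' (O.toSubgroup : Set G)
  -- The orbit map is locally constant by discreteness and `O` is compact. The orbit is finite and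
  -- its average, a rational combination, is the fixed lift.
  have hΩ : Ω.Finite := by
    let _ : TopologicalSpace V := ⊥
    have : DiscreteTopology V := ⟨rfl⟩
    refine (O.isCompact'.image (f := fun g => ρ g v) ?_).finite_of_discrete
    rw [continuous_discrete_rng]
    intro x
    by_cases hx : ∃ g, ρ g v = x
    · obtain ⟨g, rfl⟩ := hx
      have : (fun h => ρ h v) ⁻¹' {ρ g v} = (fun h => g⁻¹ * h) ⁻¹' {h : G | ρ h v = v} := by
        ext h
        simp only [Set.mem_preimage, Set.mem_singleton_iff, Set.mem_ofPred_eq, map_mul,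
          Module.End.mul_apply]
        constructor
        · intro h1
          rw [h1, Representation.inv_self_apply]
        · intro h1
          conv_rhs => rw [← h1]
          rw [Representation.self_inv_apply]
      rw [this]
      exact (hρ v).preimage (by fun_prop)
    · convert isOpen_empty
      ext h
      simpa using fun h1 => hx ⟨h, h1⟩
  have hne : hΩ.toFinset.Nonempty := ⟨v, by simpa [Ω] using ⟨1, O.toSubgroup.one_mem, by simp⟩⟩
  have hcard : (hΩ.toFinset.card : ℚ) ≠ 0 := by
    exact_mod_cast hne.card_pos.ne'
  refine ⟨(hΩ.toFinset.card : ℚ)⁻¹ • ∑ x ∈ hΩ.toFinset, x, ?_, fun g hg => ?_⟩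
  · have h1 : ∀ x ∈ hΩ.toFinset, f x = w := by
      intro x hx
      obtain ⟨g, hg, rfl⟩ := hΩ.mem_toFinset.1 hx
      rw [intertwines, hv, hw g hg]
    rw [map_smul, map_sum, Finset.sum_congr rfl h1, Finset.sum_const, ← Nat.cast_smul_eq_nsmul ℚ,
      smul_smul, inv_mul_cancel₀ hcard, one_smul]
  · rw [map_smul, map_sum]
    congr 1
    refine Finset.sum_nbij' (fun x => ρ g x) (fun x => ρ g⁻¹ x) ?_ ?_ ?_ ?_ fun _ _ => rfl
    · intro x hx
      obtain ⟨h, hh, rfl⟩ := hΩ.mem_toFinset.1 hx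
      exact hΩ.mem_toFinset.2 ⟨g * h, O.toSubgroup.mul_mem hg hh, by
        change ρ _ v = ρ _ (ρ h v)
        rw [map_mul, Module.End.mul_apply]⟩
    · intro x hx
      obtain ⟨h, hh, rfl⟩ := hΩ.mem_toFinset.1 hx
      exact hΩ.mem_toFinset.2 ⟨g⁻¹ * h, O.toSubgroup.mul_mem (O.toSubgroup.inv_mem hg) hh, by
        change ρ _ v = ρ _ (ρ h v)
        rw [map_mul, Module.End.mul_apply]⟩
    · intro x _
      exact Representation.inv_self_apply ..
    · intro x _
      exact Representation.self_inv_apply ..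

end

theorem isDiscrete_perm [IsTopologicalGroup G] (O : CompactOpenSubgroup G) :
    IsDiscrete (perm O) := fun v => by
  induction v using MonoidAlgebra.induction_linear with
  | zero => simp
  | add x y hx hy =>
    refine isOpen_repStab (repStab (perm O) x ⊓ repStab (perm O) y) (hx.inter hy) fun g hg => ?_
    rw [map_add, mem_repStab.1 hg.1, mem_repStab.1 hg.2]
  | single x c =>
    induction x using QuotientGroup.induction_on with
    | H h =>
      have : {g : G | perm O g (MonoidAlgebra.single (h : G ⧸ O.toSubgroup) c) =
          MonoidAlgebra.single (h : G ⧸ O.toSubgroup) c} ⊇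
          (fun g => h⁻¹ * g * h) ⁻¹' (O.toSubgroup : Set G) := by
        intro g hg
        change perm O g _ = _
        rw [Representation.ofMulAction_single, MulAction.Quotient.smul_coe]
        congr 1
        rw [eq_comm, QuotientGroup.eq]
        simpa [mul_assoc] using hg
      refine (repStab (perm O) _).isOpen_of_mem_nhds (g := 1) (Filter.mem_of_superset
        (IsOpen.mem_nhds (O.isOpen'.preimage (by fun_prop)) ?_) this)
      simp

/-- The transitive permutation module `ℚ[G/O]` is projective. -/
theorem isProjective_perm [IsTopologicalGroup G] (O : CompactOpenSubgroup G) :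
    IsProjective (Rep.of (perm O)) := by
  refine ⟨isDiscrete_perm O, fun A B hA hB f g hf => ?_⟩
  obtain ⟨a, ha, ha'⟩ := exists_fixed_lift hA O f hf
    (g (MonoidAlgebra.single ((1 : G) : G ⧸ O.toSubgroup) 1)) fun h hh => by
      rw [← intertwines]
      exact congrArg g (perm_single_one_fixed O hh)
  obtain ⟨h, hh⟩ := exists_perm_lift O a ha'
  refine ⟨h, perm_hom_ext ?_⟩
  have h1 := hh 1
  rw [map_one, Module.End.one_apply] at h1
  exact (congrArg f h1).trans ha

/-- The tautological presentation of `ℚ[G/O]`. -/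
def permSplitting (O : CompactOpenSubgroup G) : Splitting (Rep.of (perm O)) where
  O := O
  n := 1
  i _ := IntertwiningMap.id _
  r _ := IntertwiningMap.id _
  sum_comp := by
    rw [Fin.sum_univ_one]
    rfl

/-- The direct sum of `n` copies of `ℚ[G/O]`. -/
def permPow (O : CompactOpenSubgroup G) (n : ℕ) :
    Representation ℚ G (Fin n → MonoidAlgebra ℚ (G ⧸ O.toSubgroup)) where
  toFun g := LinearMap.pi fun k => perm O g ∘ₗ LinearMap.proj k
  map_one' := by ext : 1; simp; rfl
  map_mul' g h := by ext : 1; simp; rfl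

theorem isDiscrete_permPow [IsTopologicalGroup G] (O : CompactOpenSubgroup G) (n : ℕ) :
    IsDiscrete (permPow O n) := fun v => by
  have : {g : G | permPow O n g v = v} = ⋂ k, {g : G | perm O g (v k) = v k} := by
    ext g
    simp only [Set.mem_ofPred_eq, Set.mem_iInter, funext_iff]
    rfl
  rw [this]
  exact isOpen_iInter_of_finite fun k => isDiscrete_perm O (v k)

/-- A finitely generated projective discrete module is a direct summand of some `ℚ[G/O]ⁿ`. -/
theorem nonempty_splitting [IsTopologicalGroup G] [LocallyCompactSpace G]
    [TotallyDisconnectedSpace G] (P : Rep.{u} ℚ G) (hP : IsProjective P)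
    (hfg : IsFinitelyGenerated P) : Nonempty (Splitting P) := by
  classical
  obtain ⟨s, hs⟩ := hfg
  -- One `O` fixing all the generators gives a surjection from `ℚ[G/O]ⁿ`, which projectivity of `P`
  -- then splits.
  obtain ⟨O, hO⟩ := CompactOpenSubgroup.exists_le (⨅ m : s, repStab P.ρ m.1) (by
    rw [Subgroup.coe_iInf]
    exact isOpen_iInter_of_finite fun m => hP.1 m.1)
  let b : Fin s.card → P := fun k => (s.equivFin.symm k).1
  have hb (k) : ∀ g ∈ O.toSubgroup, P.ρ g (b k) = b k := fun g hg =>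
    mem_repStab.1 ((Subgroup.mem_iInf.1 (hO hg)) (s.equivFin.symm k))
  choose r hr using fun k => exists_perm_lift O (b k) (hb k)
  let R : (permPow O s.card).IntertwiningMap P.ρ :=
    ⟨∑ k, (r k).toLinearMap ∘ₗ LinearMap.proj k, fun g => LinearMap.ext fun a => by
      simp only [LinearMap.comp_apply, LinearMap.sum_apply, LinearMap.proj_apply, map_sum]
      exact Finset.sum_congr rfl fun k _ => intertwines (r k) g (a k)⟩
  have hR (a) : R a = ∑ k, r k (a k) := by
    change (∑ k, (r k).toLinearMap ∘ₗ LinearMap.proj k) a = _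
    simp
  have hsurj : Function.Surjective R := by
    refine (LinearMap.range_eq_top (f := R.toLinearMap)).1 ?_
    rw [eq_top_iff, ← hs, Submodule.span_le]
    rintro _ ⟨g, m, hm, rfl⟩
    refine ⟨Pi.single (s.equivFin ⟨m, hm⟩) (MonoidAlgebra.single (g : G ⧸ O.toSubgroup) 1), ?_⟩
    refine (hR _).trans ?_
    rw [Finset.sum_eq_single (s.equivFin ⟨m, hm⟩)]
    · rw [Pi.single_eq_same, hr]
      simp [b]
    · intro k _ hk
      rw [Pi.single_eq_of_ne hk, map_zero]
    · simp
  obtain ⟨h, hh⟩ := hP.2 (Rep.of (permPow O s.card)) P (isDiscrete_permPow _ _) hP.1 R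
    (IntertwiningMap.id _) hsurj
  refine ⟨⟨O, s.card, fun j => ⟨LinearMap.proj j ∘ₗ h.toLinearMap, fun g => LinearMap.ext fun x =>
    congrFun (intertwines h g x) j⟩, r, DFunLike.ext _ _ fun x => ?_⟩⟩
  rw [← hh, IntertwiningMap.sum_apply]
  exact (hR (h x)).symm

/-- Over a compactly generated group, the augmentation modules are finitely generated. -/
theorem isFinitelyGenerated_augmentationModule [IsTopologicalGroup G]
    (hcg : IsCompactlyGenerated G) (U : CompactOpenSubgroup G) :
    IsFinitelyGenerated (augmentationModule U) := by
  classical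
  obtain ⟨K, hK, hKG⟩ := hcg
  have := U.discreteTopology_quotient
  have hfin : ((QuotientGroup.mk : G → G ⧸ U.toSubgroup) '' K).Finite :=
    (hK.image QuotientGroup.continuous_mk).finite_of_discrete
  refine ⟨hfin.toFinset.image fun x => augmentationDiff U x (1 : G), ?_⟩
  set S : Submodule ℚ (augmentationModule U) := Submodule.span ℚ
    {x | ∃ g : G, ∃ m ∈ hfin.toFinset.image fun x => augmentationDiff U x (1 : G),
      x = (augmentationModule U).ρ g m} with hS
  have hSG (g : G) (x) (hx : x ∈ S) : (augmentationModule U).ρ g x ∈ S := by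
    induction hx using Submodule.span_induction with
    | mem x hx =>
      obtain ⟨h, m, hm, rfl⟩ := hx
      refine Submodule.subset_span ⟨g * h, m, hm, ?_⟩
      rw [map_mul, Module.End.mul_apply]
    | zero => rw [map_zero]; exact S.zero_mem
    | add x y _ _ hx hy => rw [map_add]; exact S.add_mem hx hy
    | smul c x _ hx => rw [map_smul]; exact S.smul_mem _ hx
  have hinj : Function.Injective (augmentationIncl U) := subrepIncl_injective _
  -- The cocycle identity `ghU - U = g (hU - U) + (gU - U)` propagates membership in `S` from `K` to
  -- the subgroup it generates.
  have hdiff (g h : G) : augmentationDiff U ((g * h : G) : G ⧸ U.toSubgroup) (1 : G) =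
      (augmentationModule U).ρ g (augmentationDiff U (h : G) (1 : G)) +
        augmentationDiff U (g : G) (1 : G) := by
    apply hinj
    have e1 : augmentationIncl U ((augmentationModule U).ρ g (augmentationDiff U (h : G) (1 : G)) +
        augmentationDiff U (g : G) (1 : G)) =
        perm U g (augmentationIncl U (augmentationDiff U (h : G) (1 : G))) +
          augmentationIncl U (augmentationDiff U (g : G) (1 : G)) := by
      rw [map_add, intertwines]
    rw [e1, augmentationIncl_diff, augmentationIncl_diff, augmentationIncl_diff,
      map_sub (perm U g), Representation.ofMulAction_single, Representation.ofMulAction_single,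
      MulAction.Quotient.smul_coe, MulAction.Quotient.smul_coe, smul_eq_mul, smul_eq_mul, mul_one,
      sub_add_sub_cancel]
  have h1 : augmentationDiff U ((1 : G) : G ⧸ U.toSubgroup) (1 : G) = 0 :=
    hinj (by rw [augmentationIncl_diff, sub_self, map_zero])
  have hmem (g : G) : augmentationDiff U (g : G ⧸ U.toSubgroup) (1 : G) ∈ S := by
    have hg : g ∈ Subgroup.closure K := hKG ▸ Subgroup.mem_top g
    induction hg using Subgroup.closure_induction with
    | mem x hx =>
      refine Submodule.subset_span ⟨1, _, Finset.mem_image.2 ⟨_, hfin.mem_toFinset.2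
        ⟨x, hx, rfl⟩, rfl⟩, ?_⟩
      rw [map_one, Module.End.one_apply]
    | one => rw [h1]; exact S.zero_mem
    | mul a b _ _ ha hb => rw [hdiff]; exact S.add_mem (hSG _ _ hb) ha
    | inv a _ ha =>
      have h2 := hdiff a⁻¹ a
      rw [inv_mul_cancel, h1] at h2
      rw [eq_neg_of_add_eq_zero_right h2.symm]
      exact S.neg_mem (hSG _ _ ha)
  rw [eq_top_iff]
  intro x _
  have hx : x.1.coeff.sum (fun _ c => c) = 0 := (augmentation_apply U x.1).symm.trans x.2
  -- Subtracting the base coset from every term changes nothing, as the coefficients sum to zero.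
  have hx2 : x = ∑ y ∈ x.1.coeff.support, x.1.coeff y • augmentationDiff U y (1 : G) := by
    refine hinj ?_
    simp_rw [map_sum, map_smul, augmentationIncl_diff, smul_sub, Finset.sum_sub_distrib,
      ← Finset.sum_smul]
    rw [Finsupp.sum] at hx
    rw [hx, zero_smul, sub_zero]
    change x.1 = _
    conv_lhs => rw [← MonoidAlgebra.sum_coeff_single x.1, Finsupp.sum]
    simp
  rw [hx2]
  refine S.sum_mem fun y _ => S.smul_mem _ ?_
  induction y using QuotientGroup.induction_on with
  | H g => exact hmem g

end PermModules

/-! ### Split exact sequences and lifting over the trivial module -/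

section ShortExact

variable {G : Type u} [Group G] [TopologicalSpace G]

omit [TopologicalSpace G] in
theorem IsFinitelyGenerated.of_surjective {P Q : Rep.{u} ℚ G} (hP : IsFinitelyGenerated P)
    (f : P.ρ.IntertwiningMap Q.ρ) (hf : Function.Surjective f) : IsFinitelyGenerated Q := by
  classical
  obtain ⟨s, hs⟩ := hP
  refine ⟨s.image f, ?_⟩
  rw [eq_top_iff, ← (LinearMap.range_eq_top (f := f.toLinearMap)).2 hf, ← Submodule.map_top, ← hs,
    Submodule.map_span, Submodule.span_le]
  rintro _ ⟨_, ⟨g, m, hm, rfl⟩, rfl⟩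
  exact Submodule.subset_span ⟨g, f m, Finset.mem_image_of_mem _ hm, intertwines f g m⟩

/-- The kernel of a surjection of a projective module onto a projective module is a direct
summand. -/
theorem exists_retraction_ker {A B : Rep.{u} ℚ G} (hA : IsDiscrete A.ρ) (hB : IsProjective B)
    (f : A.ρ.IntertwiningMap B.ρ) (hf : Function.Surjective f) :
    ∃ (s : B.ρ.IntertwiningMap A.ρ) (p : A.ρ.IntertwiningMap f.ker.toRepresentation),
      (∀ b, f (s b) = b) ∧ (∀ x, p (subrepIncl f.ker x) = x) ∧
      ∀ a, subrepIncl f.ker (p a) + s (f a) = a := by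
  obtain ⟨s, hs⟩ := hB.2 A B hA hB.1 f (IntertwiningMap.id _) hf
  have hs (b) : f (s b) = b := congrArg (fun h => h b) hs
  obtain ⟨p, hp⟩ := exists_factor_of_injective (subrepIncl f.ker) (subrepIncl_injective _)
    (IntertwiningMap.id A.ρ - s.comp f) fun a => ⟨⟨a - s (f a), by
      change f (a - s (f a)) = 0
      rw [map_sub, hs, sub_self]⟩, rfl⟩
  have hp (a) : subrepIncl f.ker (p a) = a - s (f a) := hp a
  refine ⟨s, p, hs, fun x => subrepIncl_injective _ ?_, fun a => by rw [hp, sub_add_cancel]⟩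
  have hx : f (subrepIncl f.ker x) = 0 := x.2
  rw [hp, hx, map_zero, sub_zero]

theorem IsProjective.of_retract {A K : Rep.{u} ℚ G} (hA : IsProjective A)
    (i : K.ρ.IntertwiningMap A.ρ) (p : A.ρ.IntertwiningMap K.ρ) (hpi : ∀ x, p (i x) = x) :
    IsProjective K := by
  refine ⟨hA.1.of_injective i (Function.LeftInverse.injective hpi), fun X Y hX hY f g hf => ?_⟩
  obtain ⟨h, hh⟩ := hA.2 X Y hX hY f (g.comp p) hf
  refine ⟨h.comp i, DFunLike.ext _ _ fun x => ?_⟩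
  have h1 : f (h (i x)) = g (p (i x)) := congrArg (fun l => l (i x)) hh
  rw [hpi] at h1
  exact h1

theorem IsProjective.exists_lift_trivial {P F : Rep.{u} ℚ G} (hP : IsProjective P)
    (hF : IsDiscrete F.ρ) (ε : P.ρ.IntertwiningMap (Representation.trivial ℚ G ℚ))
    (η : F.ρ.IntertwiningMap (Representation.trivial ℚ G ℚ)) (hη : Function.Surjective η) :
    ∃ a : P.ρ.IntertwiningMap F.ρ, ∀ x, η (a x) = ε x := by
  -- `IsProjective` tests only modules in the universe of `G`, so `ℚ` is lifted there.
  let up : (Representation.trivial ℚ G ℚ).IntertwiningMap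
      (Representation.trivial ℚ G (ULift.{u} ℚ)) :=
    ⟨ULift.moduleEquiv.symm.toLinearMap, fun g => rfl⟩
  obtain ⟨a, ha⟩ := hP.2 F (Rep.of (Representation.trivial ℚ G (ULift.{u} ℚ))) hF
    isDiscrete_trivial (up.comp η) (up.comp ε) fun y => by
      obtain ⟨x, hx⟩ := hη y.down
      exact ⟨x, ULift.ext _ _ hx⟩
  exact ⟨a, fun x => congrArg ULift.down (congrArg (fun l => l x) ha)⟩

end ShortExact

/-! ### Additivity of the Hattori–Stallings rank -/

section Rank

variable {G : Type u} [Group G] [TopologicalSpace G] [IsTopologicalGroup G]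
  [LocallyCompactSpace G] [MeasurableSpace G] [BorelSpace G]

open Classical in
/-- The real number `r` such that the Hattori–Stallings rank is `r` times the reference
Haar measure. -/
def realRank (P : Rep.{u} ℚ G) : ℝ :=
  if h : Nonempty (Splitting P) then h.some.trace (IntertwiningMap.id P.ρ) else 0

theorem coe_hsRank (P : Rep.{u} ℚ G) :
    (hsRank P : CompactlySupportedContinuousMap G ℝ →ₗ[ℝ] ℝ) = realRank P • haarIntegral := by
  by_cases h : Nonempty (Splitting P)
  · rw [hsRank, realRank, dif_pos h, dif_pos h, Splitting.coe_rank]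
  · rw [hsRank, realRank, dif_neg h, dif_neg h, zero_smul]
    rfl

variable (hcg : IsCompactlyGenerated G) (huni : IsUnimodular G)

include hcg huni

theorem Splitting.trace_id {P : Rep.{u} ℚ G} (s : Splitting P) :
    s.trace (IntertwiningMap.id P.ρ) = realRank P := by
  have h : Nonempty (Splitting P) := ⟨s⟩
  rw [realRank, dif_pos h]
  exact s.trace_comp_comm hcg huni h.some (IntertwiningMap.id _) (IntertwiningMap.id _)

theorem realRank_perm (O : CompactOpenSubgroup G) : realRank (Rep.of (perm O)) = O.vol⁻¹ := by
  rw [← (permSplitting O).trace_id hcg huni, Splitting.trace]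
  have h (j) : permTrace (((permSplitting O).i j).comp ((IntertwiningMap.id (perm O)).comp
      ((permSplitting O).r j))) = 1 := by
    change (MonoidAlgebra.single ((1 : G) : G ⧸ O.toSubgroup) (1 : ℚ)).coeff _ = 1
    rw [MonoidAlgebra.coeff_single]
    exact Finsupp.single_eq_same
  refine (congrArg _ (congrArg _ (Finset.sum_congr rfl fun j _ => h j))).trans ?_
  change O.vol⁻¹ * ((∑ _j : Fin 1, (1 : ℚ) : ℚ) : ℝ) = _
  simp

theorem realRank_eq_zero {P : Rep.{u} ℚ G} [Subsingleton P] (s : Splitting P) :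
    realRank P = 0 := by
  rw [← s.trace_id hcg huni]
  have h : IntertwiningMap.id P.ρ = IntertwiningMap.id P.ρ + IntertwiningMap.id P.ρ :=
    DFunLike.ext _ _ fun x => Subsingleton.elim _ _
  have h2 := s.trace_add (IntertwiningMap.id P.ρ) (IntertwiningMap.id P.ρ)
  rw [← h] at h2
  linarith

/-- For a splitting with `id = i p + s f`, cyclicity turns the two terms into the traces of `p i =
id` and `f s = id`. -/
theorem realRank_eq_add {A B : Rep.{u} ℚ G} (hA : IsDiscrete A.ρ) (hB : IsProjective B)
    (f : A.ρ.IntertwiningMap B.ρ) (hf : Function.Surjective f) (sA : Splitting A)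
    (sB : Splitting B) (sK : Splitting (Rep.of f.ker.toRepresentation)) :
    realRank A = realRank (Rep.of f.ker.toRepresentation) + realRank B := by
  obtain ⟨s, p, hfs, hp, hsum⟩ := exists_retraction_ker hA hB f hf
  let i : (Rep.of f.ker.toRepresentation).ρ.IntertwiningMap A.ρ := subrepIncl f.ker
  let p' : A.ρ.IntertwiningMap (Rep.of f.ker.toRepresentation).ρ := p
  have h1 : IntertwiningMap.id A.ρ = i.comp p' + s.comp f :=
    DFunLike.ext _ _ fun a => (hsum a).symm
  have h2 : p'.comp i = IntertwiningMap.id _ := DFunLike.ext _ _ hp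
  have h3 : f.comp s = IntertwiningMap.id _ := DFunLike.ext _ _ hfs
  rw [← sA.trace_id hcg huni, ← sB.trace_id hcg huni, ← sK.trace_id hcg huni, h1, sA.trace_add,
    sA.trace_comp_comm hcg huni sK, sA.trace_comp_comm hcg huni sB, h2, h3]

/-- Schanuel's lemma for the ranks of two projective covers of the trivial module. -/
theorem realRank_sub_eq {P F : Rep.{u} ℚ G} (hP : IsProjective P) (hF : IsProjective F)
    (ε : P.ρ.IntertwiningMap (Representation.trivial ℚ G ℚ)) (hε : Function.Surjective ε)
    (η : F.ρ.IntertwiningMap (Representation.trivial ℚ G ℚ)) (hη : Function.Surjective η)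
    (sP : Splitting P) (sF : Splitting F) (sK : Splitting (Rep.of ε.ker.toRepresentation))
    (sN : Splitting (Rep.of η.ker.toRepresentation)) :
    realRank P - realRank (Rep.of ε.ker.toRepresentation) =
      realRank F - realRank (Rep.of η.ker.toRepresentation) := by
  obtain ⟨a, ha⟩ := hP.exists_lift_trivial hF.1 ε η hη
  obtain ⟨b, hb⟩ := hF.exists_lift_trivial hP.1 η ε hε
  let i : (Rep.of ε.ker.toRepresentation).ρ.IntertwiningMap P.ρ := subrepIncl ε.ker
  let j : (Rep.of η.ker.toRepresentation).ρ.IntertwiningMap F.ρ := subrepIncl η.ker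
  have hi (x) : ε (i x) = 0 := x.2
  have hj (x) : η (j x) = 0 := x.2
  have hiinj : Function.Injective i := subrepIncl_injective _
  have hjinj : Function.Injective j := subrepIncl_injective _
  obtain ⟨a', ha'⟩ := exists_factor_of_injective j hjinj (a.comp i) fun x =>
    ⟨⟨a (i x), (ha _).trans (hi x)⟩, rfl⟩
  obtain ⟨b', hb'⟩ := exists_factor_of_injective i hiinj (b.comp j) fun x =>
    ⟨⟨b (j x), (hb _).trans (hj x)⟩, rfl⟩
  obtain ⟨κ, hκ⟩ := exists_factor_of_injective i hiinj (IntertwiningMap.id P.ρ - b.comp a)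
    fun x => ⟨⟨x - b (a x), by
      change ε (x - b (a x)) = 0
      rw [map_sub, hb, ha, sub_self]⟩, rfl⟩
  obtain ⟨l, hl⟩ := exists_factor_of_injective j hjinj (IntertwiningMap.id F.ρ - a.comp b)
    fun x => ⟨⟨x - a (b x), by
      change η (x - a (b x)) = 0
      rw [map_sub, ha, hb, sub_self]⟩, rfl⟩
  have ha' (x) : j (a' x) = a (i x) := ha' x
  have hb' (x) : i (b' x) = b (j x) := hb' x
  have hκ (x) : i (κ x) = x - b (a x) := hκ x
  have hl (x) : j (l x) = x - a (b x) := hl x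
  -- By cyclicity the terms through `κ` cancel between `e1` and `e3`, and those through `l` between
  -- `e2` and `e4`. Both differences of ranks become `tr (a b) - tr (a' b')`.
  have e1 : IntertwiningMap.id P.ρ = b.comp a + i.comp κ := DFunLike.ext _ _ fun x => by
    change x = b (a x) + i (κ x)
    rw [hκ, add_sub_cancel]
  have e2 : IntertwiningMap.id F.ρ = a.comp b + j.comp l := DFunLike.ext _ _ fun x => by
    change x = a (b x) + j (l x)
    rw [hl, add_sub_cancel]
  have e3 : IntertwiningMap.id (Rep.of ε.ker.toRepresentation).ρ = b'.comp a' + κ.comp i :=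
    DFunLike.ext _ _ fun x => hiinj <| by
      change i x = i (b' (a' x) + κ (i x))
      rw [map_add, hb', hκ, ha', add_sub_cancel]
  have e4 : IntertwiningMap.id (Rep.of η.ker.toRepresentation).ρ = a'.comp b' + l.comp j :=
    DFunLike.ext _ _ fun x => hjinj <| by
      change j x = j (a' (b' x) + l (j x))
      rw [map_add, ha', hl, hb', add_sub_cancel]
  rw [← sP.trace_id hcg huni, ← sF.trace_id hcg huni, ← sK.trace_id hcg huni,
    ← sN.trace_id hcg huni, e1, e2, e3, e4, sP.trace_add, sF.trace_add, sK.trace_add,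
    sN.trace_add, sP.trace_comp_comm hcg huni sF a b, sK.trace_comp_comm hcg huni sN a' b',
    sP.trace_comp_comm hcg huni sK κ i, sF.trace_comp_comm hcg huni sN l j]
  ring

variable [TotallyDisconnectedSpace G]

/-- The alternating sum of the ranks in a finite projective resolution of a projective module. -/
theorem sum_realRank_eq (n : ℕ) (P : ℕ → Rep.{u} ℚ G) (hP : ∀ i, IsProjective (P i))
    (hfg : ∀ i, IsFinitelyGenerated (P i)) (d : ∀ i, (P (i + 1)).ρ.IntertwiningMap (P i).ρ)
    (hd : ∀ i, Function.Exact (d (i + 1)) (d i)) (hn : ∀ i, n ≤ i → Subsingleton (P i))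
    (B : Rep.{u} ℚ G) (hB : IsProjective B) (f : (P 0).ρ.IntertwiningMap B.ρ)
    (hf : Function.Surjective f) (hdf : Function.Exact (d 0) f) :
    ∑ i ∈ Finset.range n, (-1 : ℝ) ^ i * realRank (P i) = realRank B := by
  induction n generalizing P B with
  | zero =>
    have := hn 0 le_rfl
    have : Subsingleton B := hf.subsingleton
    have sB := (nonempty_splitting B hB ((hfg 0).of_surjective f hf)).some
    rw [realRank_eq_zero hcg huni sB, Finset.sum_range_zero]
  | succ n ih =>
    -- `f` splits, so its kernel is again finitely generated projective and is resolved by the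
    -- shifted sequence.
    let K : Rep.{u} ℚ G := Rep.of f.ker.toRepresentation
    let i : K.ρ.IntertwiningMap (P 0).ρ := subrepIncl f.ker
    have hi : Function.Injective i := subrepIncl_injective _
    obtain ⟨s, p, -, hp, -⟩ := exists_retraction_ker (hP 0).1 hB f hf
    have hK : IsProjective K := (hP 0).of_retract i p hp
    have hKfg : IsFinitelyGenerated K := (hfg 0).of_surjective p fun x => ⟨i x, hp x⟩
    obtain ⟨d', hd'⟩ := exists_factor_of_injective i hi (d 0) fun x =>
      ⟨⟨d 0 x, (hdf _).2 ⟨x, rfl⟩⟩, rfl⟩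
    have h := ih (fun k => P (k + 1)) (fun k => hP _) (fun k => hfg _) (fun k => d (k + 1))
      (fun k => hd _) (fun k hk => hn _ (by omega)) K hK d' (fun x => by
        obtain ⟨y, hy⟩ := (hdf (i x)).1 x.2
        exact ⟨y, hi ((hd' y).trans hy)⟩) fun x => by
        rw [← hd 0 x, ← hd']
        exact (map_eq_zero_iff i hi).symm
    have sA := (nonempty_splitting _ (hP 0) (hfg 0)).some
    have sB := (nonempty_splitting B hB ((hfg 0).of_surjective f hf)).some
    have sK := (nonempty_splitting K hK hKfg).some
    have hadd := realRank_eq_add hcg huni (hP 0).1 hB f hf sA sB sK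
    rw [Finset.sum_range_succ', hadd]
    simp_rw [pow_succ, mul_neg_one, neg_mul, Finset.sum_neg_distrib]
    rw [h]
    simp [K]

/-- `eulerChar` uses an arbitrarily chosen resolution, so the formula is needed for every `R`. The
kernel of `R.ε` is projective since `cdQ G ≤ 1`; the tail of `R` computes its rank, and Schanuel's
lemma compares with `ℚ[G/U]`. -/
theorem coe_rank_eq (hcd : cdQ G ≤ 1)
    (R : FiniteProjectiveResolution (Representation.trivial ℚ G ℚ)) (U : CompactOpenSubgroup G)
    (sN : Splitting (augmentationModule U)) (hη : Function.Surjective (augmentation U)) :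
    (R.rank : CompactlySupportedContinuousMap G ℝ →ₗ[ℝ] ℝ) =
      (U.vol⁻¹ - realRank (augmentationModule U)) • haarIntegral := by
  let K : Rep.{u} ℚ G := Rep.of R.ε.ker.toRepresentation
  let i : K.ρ.IntertwiningMap (R.P 0).ρ := subrepIncl R.ε.ker
  have hi : Function.Injective i := subrepIncl_injective _
  have hK : IsProjective K := isProjective_ker hcd (R.P 0) (R.projective 0) R.ε R.ε_surjective
  obtain ⟨d', hd'⟩ := exists_factor_of_injective i hi (R.d 0) fun x =>
    ⟨⟨R.d 0 x, (R.exact_zero _).2 ⟨x, rfl⟩⟩, rfl⟩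
  have hd'surj : Function.Surjective d' := fun x => by
    obtain ⟨y, hy⟩ := (R.exact_zero (i x)).1 x.2
    exact ⟨y, hi ((hd' y).trans hy)⟩
  have hsum := sum_realRank_eq hcg huni R.length (fun k => R.P (k + 1))
    (fun k => R.projective _) (fun k => R.finitelyGenerated _) (fun k => R.d (k + 1))
    (fun k => R.exact_succ _) (fun k hk => R.subsingleton _ (by omega)) K hK d' hd'surj
    fun x => by
      rw [← R.exact_succ 0 x, ← hd']
      exact (map_eq_zero_iff i hi).symm
  have sP := (nonempty_splitting _ (R.projective 0) (R.finitelyGenerated 0)).some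
  have sK := (nonempty_splitting K hK ((R.finitelyGenerated 1).of_surjective d' hd'surj)).some
  have hsch := realRank_sub_eq hcg huni (R.projective 0) (isProjective_perm U) R.ε
    R.ε_surjective (augmentation U) hη sP (permSplitting U) sK sN
  rw [realRank_perm hcg huni] at hsch
  have key : ∑ k ∈ Finset.range (R.length + 1), (-1 : ℝ) ^ k * realRank (R.P k) =
      U.vol⁻¹ - realRank (augmentationModule U) := by
    refine Eq.trans ?_ hsch
    rw [Finset.sum_range_succ']
    simp_rw [pow_succ, mul_neg_one, neg_mul, Finset.sum_neg_distrib]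
    rw [hsum, pow_zero, one_mul]
    ring
  rw [← key, FiniteProjectiveResolution.rank, Submodule.coe_sum, Finset.sum_smul]
  refine Finset.sum_congr rfl fun k _ => ?_
  rw [Submodule.coe_smul, coe_hsRank]
  ext f
  simp [Rat.smul_def, mul_assoc]

end Rank

/-! ### The length-one resolution of the trivial module -/

section TypeFP

variable {G : Type u} [Group G] [TopologicalSpace G]

theorem augmentation_surjective (U : CompactOpenSubgroup G) :
    Function.Surjective (augmentation U) := fun c =>
  ⟨MonoidAlgebra.single ((1 : G) : G ⧸ U.toSubgroup) c, augmentation_single U _ c⟩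

theorem isFinitelyGenerated_perm (U : CompactOpenSubgroup G) :
    IsFinitelyGenerated (Rep.of (perm U)) := by
  refine ⟨{MonoidAlgebra.single ((1 : G) : G ⧸ U.toSubgroup) 1}, ?_⟩
  rw [eq_top_iff]
  intro x _
  rw [← MonoidAlgebra.sum_coeff_single x, Finsupp.sum]
  refine Submodule.sum_mem _ fun y _ => ?_
  rw [show MonoidAlgebra.single y (x.coeff y) = x.coeff y • MonoidAlgebra.single y (1 : ℚ) by
    rw [MonoidAlgebra.smul_single, smul_eq_mul, mul_one]]
  refine Submodule.smul_mem _ _ (Submodule.subset_span ?_)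
  induction y using QuotientGroup.induction_on with
  | H g =>
    refine ⟨g, _, Finset.mem_singleton_self _, ?_⟩
    change _ = perm U g _
    rw [Representation.ofMulAction_single, MulAction.Quotient.smul_coe, smul_eq_mul, mul_one]

/-- The zero module. -/
abbrev zeroRep : Rep.{u} ℚ G := Rep.of (Representation.trivial ℚ G PUnit.{u + 1})

theorem isProjective_zeroRep : IsProjective (zeroRep : Rep.{u} ℚ G) :=
  ⟨isDiscrete_trivial, fun _ _ _ _ f g _ => ⟨0, DFunLike.ext _ _ fun x => by
    rw [Subsingleton.elim x 0, map_zero, map_zero]⟩⟩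

omit [TopologicalSpace G] in
theorem isFinitelyGenerated_zeroRep : IsFinitelyGenerated (zeroRep : Rep.{u} ℚ G) :=
  ⟨∅, Subsingleton.elim _ _⟩

/-- The modules `⋯ → 0 → N_U → ℚ[G/U]`. -/
def augmentationComplex (U : CompactOpenSubgroup G) : ℕ → Rep.{u} ℚ G
  | 0 => Rep.of (perm U)
  | 1 => augmentationModule U
  | _ + 2 => zeroRep

/-- The resolution `0 → N_U → ℚ[G/U] → ℚ → 0`. -/
def augmentationResolution [IsTopologicalGroup G] (U : CompactOpenSubgroup G)
    (hN : IsProjective (augmentationModule U))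
    (hfg : IsFinitelyGenerated (augmentationModule U)) :
    FiniteProjectiveResolution (Representation.trivial ℚ G ℚ) where
  length := 1
  P := augmentationComplex U
  projective
    | 0 => isProjective_perm U
    | 1 => hN
    | _ + 2 => isProjective_zeroRep
  finitelyGenerated
    | 0 => isFinitelyGenerated_perm U
    | 1 => hfg
    | _ + 2 => isFinitelyGenerated_zeroRep
  subsingleton
    | 0, h => absurd h (by omega)
    | 1, h => absurd h (by omega)
    | _ + 2, _ => inferInstanceAs (Subsingleton PUnit)
  ε := augmentation U
  d
    | 0 => augmentationIncl U
    | _ + 1 => 0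
  ε_surjective := augmentation_surjective U
  exact_zero x := ⟨fun hx => ⟨⟨x, hx⟩, rfl⟩, by rintro ⟨y, rfl⟩; exact y.2⟩
  exact_succ
    | 0 => fun x => ⟨fun hx => ⟨0, (subrepIncl_injective (augmentation U).ker
        (hx.trans (map_zero (augmentationIncl U)).symm)).symm⟩, by
        rintro ⟨y, rfl⟩; exact map_zero (augmentationIncl U)⟩
    | _ + 1 => fun x => ⟨fun _ => ⟨0, Subsingleton.elim (α := PUnit) _ _⟩, fun _ => rfl⟩

end TypeFP

end TDLC

end

/-! ### The main theorem -/

open TDLC in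
theorem mainTheorem3 {G : Type*} [Group G] [TopologicalSpace G] [IsTopologicalGroup G]
    [LocallyCompactSpace G] [TotallyDisconnectedSpace G] [MeasurableSpace G] [BorelSpace G]
    (hcg : TDLC.IsCompactlyGenerated G) (huni : TDLC.IsUnimodular G) (hcd : TDLC.cdQ G ≤ 1) :
    TDLC.IsTypeFP G ∧
      ∀ U : TDLC.CompactOpenSubgroup G, U.toSubgroup ≠ ⊤ →
        (TDLC.IsProjective (TDLC.augmentationModule U) ∧
          TDLC.IsFinitelyGenerated (TDLC.augmentationModule U) ∧
          (1 / 2 : ℚ) • U.haar ≤ TDLC.hsRank (TDLC.augmentationModule U)) ∧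
        TDLC.eulerChar G ≤ (1 / 2 : ℚ) • U.haar := by
  have hproj (U : CompactOpenSubgroup G) : IsProjective (augmentationModule U) :=
    isProjective_ker hcd (Rep.of (perm U)) (isProjective_perm U) (augmentation U)
      (augmentation_surjective U)
  have hfg (U : CompactOpenSubgroup G) := isFinitelyGenerated_augmentationModule hcg U
  have hFP : IsTypeFP G := by
    obtain ⟨U⟩ := nonempty_compactOpenSubgroup (G := G)
    exact ⟨augmentationResolution U (hproj U) (hfg U)⟩
  refine ⟨hFP, fun U hU => ?_⟩
  obtain ⟨s⟩ := nonempty_splitting _ (hproj U) (hfg U)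
  have hle := half_le_trace_augmentationModule hcg huni U hU s
  rw [s.trace_id hcg huni] at hle
  have hhaar (f : CompactlySupportedContinuousMap G ℝ) :
      (((1 / 2 : ℚ) • U.haar : haarSpace G) : CompactlySupportedContinuousMap G ℝ →ₗ[ℝ] ℝ) f =
        1 / 2 * U.vol⁻¹ * haarIntegral f := by
    change ((1 / 2 : ℚ) • U.haarFunctional) f = _
    rw [U.haarFunctional_eq, LinearMap.smul_apply, LinearMap.smul_apply, Rat.smul_def,
      smul_eq_mul, mul_assoc]
    norm_num
  refine ⟨⟨hproj U, hfg U, fun f hf => ?_⟩, fun f hf => ?_⟩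
  · rw [hhaar, coe_hsRank, LinearMap.smul_apply, smul_eq_mul]
    exact mul_le_mul_of_nonneg_right hle (haarIntegral_nonneg f hf)
  · rw [hhaar, eulerChar, hsRankFP,
      dif_pos (show Nonempty (FiniteProjectiveResolution (Representation.trivial ℚ G ℚ)) from hFP),
      coe_rank_eq hcg huni hcd _ U s (augmentation_surjective U), LinearMap.smul_apply,
      smul_eq_mul]
    exact mul_le_mul_of_nonneg_right (by linarith) (haarIntegral_nonneg f hf)
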